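/- Let $0\le d\le n$ be integers, let $E=\{1,\dots,n\}$, and let $\mathsf U_{d,n}$ be the uniform matroid of rank $d$ on $E$, whose independent sets are the subsets of $E$ with at most $d$ elements. For a matroid $\mathsf M$ on $E$, a proper flat is a flat different from $E$. The augmented Bergman complex $\Delta_{\mathsf M}$ is the simplicial complex on the vertices $u_i$ ($i\in E$) and $v_F$ ($F$ a proper flat of $\mathsf M$) whose faces are the sets $\{u_i : i\in S\}\cup\{v_{F_1},\dots,v_{F_k}\}$ with $k\ge 0$, where $S$ is an independent set of $\mathsf M$, $F_1\subsetneq\cdots\subsetneq F_k$ are proper flats and, if $k\ge 1$, $S\subseteq F_1$. The $h$-polynomial of a $(d-1)$-dimensional simplicial complex $\Delta$ is $h(\Delta,x)=\sum_{\sigma\in\Delta}x^{|\sigma|}(1-x)^{d-|\sigma|}$, where the sum includes the empty face. The augmented Chow ring of $\mathsf M$ is the graded $\mathbb Q$-algebra $$\mathrm{CH}(\mathsf M)=\mathbb Q[\,y_i,\ x_F : i\in E,\ F \text{ a proper flat}\,]/(I+J),$$ with all variables in degree $1$, where $I$ is generated by the elements $y_i-\sum_{F\not\ni i}x_F$ for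 $i\in E$ (the sum is over proper flats), and $J$ by the products $x_Fx_G$ for incomparable proper flats $F,G$ and the products $y_ix_F$ for $i\notin F$. Let $\mathrm H_{\mathsf M}(x)=\sum_{k\ge 0}\dim_{\mathbb Q}\mathrm{CH}^k(\mathsf M)\,x^k$ be its Hilbert–Poincaré series. Then $$x^{d}\,h(\Delta_{\mathsf U_{d,n}},x^{-1})=\sum_{i=0}^{d}\binom{n-i-1}{d-i}\,\mathrm H_{\mathsf U_{i,n}}(x),$$ where $\binom{-1}{0}=1$ (this occurs only for $i=d=n$). -/

import Mathlib

/-- A finite abstract simplicial complex on a vertex set `V`: a downward closed family of finite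
subsets of `V` which contains the empty face (not every element of `V` has to be a face). -/
structure FinSimplicialComplex (V : Type*) where
  faces : Finset (Finset V)
  empty_mem : ∅ ∈ faces
  down_closed : ∀ σ ∈ faces, ∀ τ : Finset V, τ ⊆ σ → τ ∈ faces

/-- The largest cardinality of a face, that is, the number `d` such that the complex is
`(d - 1)`-dimensional. -/
def FinSimplicialComplex.maxCard {V : Type*} (Δ : FinSimplicialComplex V) : ℕ :=
  Δ.faces.sup Finset.card

/-- The `h`-polynomial `∑_{σ ∈ Δ} x^|σ| (1 - x)^(d - |σ|)` of a `(d - 1)`-dimensional complex. -/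
noncomputable def FinSimplicialComplex.hPolynomial {V : Type*} (Δ : FinSimplicialComplex V) :
    Polynomial ℤ :=
  ∑ σ ∈ Δ.faces, Polynomial.X ^ σ.card * (1 - Polynomial.X) ^ (Δ.maxCard - σ.card)

namespace Matroid

/-- The proper flats of a matroid: all flats except the ground set. -/
abbrev ProperFlat {α : Type*} (M : Matroid α) : Type _ :=
  {F : Set α // M.IsFlat F ∧ F ≠ M.E}

/-- `Sum.inl i` stands for the vertex `u_i` of the augmented Bergman complex (the variable `y_i` of
the augmented Chow ring), for `i` in the ground set; `Sum.inr F` stands for the vertex `v_F` (the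
variable `x_F`), for `F` a proper flat. -/
abbrev AugVertex {α : Type*} (M : Matroid α) : Type _ :=
  M.E ⊕ M.ProperFlat

/-- The set `{u_i : i ∈ S} ∪ {v_{F_1}, …, v_{F_k}}` is a face of the augmented Bergman complex if
and only if `S` is independent, the flats `F_1, …, F_k` form a chain, and each of them
contains `S`. -/
def IsAugFace {α : Type*} (M : Matroid α) (σ : Finset M.AugVertex) : Prop :=
  M.Indep {a : α | ∃ i : M.E, (i : α) = a ∧ Sum.inl i ∈ σ} ∧
  (∀ F G : M.ProperFlat, Sum.inr F ∈ σ → Sum.inr G ∈ σ → F.1 ⊆ G.1 ∨ G.1 ⊆ F.1) ∧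
  (∀ (i : M.E) (F : M.ProperFlat), Sum.inl i ∈ σ → Sum.inr F ∈ σ → (i : α) ∈ F.1)

/-- The augmented Bergman complex of a matroid. -/
noncomputable def augmentedBergmanComplex {α : Type*} [Finite α] (M : Matroid α) :
    FinSimplicialComplex M.AugVertex where
  faces := (Set.toFinite {σ : Finset M.AugVertex | M.IsAugFace σ}).toFinset
  empty_mem := by simp [IsAugFace]
  down_closed := by
    intro σ hσ τ hτ
    simp only [Set.Finite.mem_toFinset, Set.mem_ofPred_eq] at hσ ⊢
    obtain ⟨h1, h2, h3⟩ := hσ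
    refine ⟨h1.subset ?_, fun F G hF hG => h2 F G (hτ hF) (hτ hG),
      fun i F hi hF => h3 i F (hτ hi) (hτ hF)⟩
    rintro a ⟨i, hi, hiτ⟩
    exact ⟨i, hi, hτ hiτ⟩

/-- The ideal of relations of the augmented Chow ring, generated by
`y_i - ∑_{F ∌ i} x_F` for `i` in the ground set, by `x_F x_G` for incomparable proper flats
`F`, `G`, and by `y_i x_F` for `i ∉ F`. -/
noncomputable def augmentedChowIdeal {α : Type*} [Finite α] (M : Matroid α) :
    Ideal (MvPolynomial M.AugVertex ℚ) :=
  Ideal.span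
    ({p | ∃ i : M.E, p = MvPolynomial.X (Sum.inl i) -
        ∑ F ∈ (Set.toFinite {F : M.ProperFlat | (i : α) ∉ F.1}).toFinset,
          MvPolynomial.X (Sum.inr F)} ∪
      {p | ∃ F G : M.ProperFlat, ¬ F.1 ⊆ G.1 ∧ ¬ G.1 ⊆ F.1 ∧
        p = MvPolynomial.X (Sum.inr F) * MvPolynomial.X (Sum.inr G)} ∪
      {p | ∃ (i : M.E) (F : M.ProperFlat), (i : α) ∉ F.1 ∧
        p = MvPolynomial.X (Sum.inl i) * MvPolynomial.X (Sum.inr F)})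

/-- The augmented Chow ring of a matroid, with rational coefficients. -/
abbrev AugmentedChowRing {α : Type*} [Finite α] (M : Matroid α) : Type _ :=
  MvPolynomial M.AugVertex ℚ ⧸ M.augmentedChowIdeal

/-- The degree `k` piece of the augmented Chow ring: the classes of the homogeneous polynomials
of degree `k` (all variables have degree one, and the relations are homogeneous). -/
noncomputable def augmentedChowPiece {α : Type*} [Finite α] (M : Matroid α) (k : ℕ) :
    Submodule ℚ M.AugmentedChowRing :=
  (MvPolynomial.homogeneousSubmodule M.AugVertex ℚ k).map
    (Ideal.Quotient.mkₐ ℚ M.augmentedChowIdeal).toLinearMap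

/-- The Hilbert–Poincaré series of the augmented Chow ring. -/
noncomputable def augmentedChowSeries {α : Type*} [Finite α] (M : Matroid α) : PowerSeries ℤ :=
  PowerSeries.mk fun k => (Module.finrank ℚ (M.augmentedChowPiece k) : ℤ)

/-- The uniform matroid on the ground set `Fin n`, whose independent sets are the sets with at
most `d` elements; it has rank `d` if `d ≤ n`. -/
def uniformMatroid (d n : ℕ) : Matroid (Fin n) :=
  (IndepMatroid.ofFinite (E := Set.univ) Set.finite_univ (fun I => I.ncard ≤ d)
    (by simp)
    (fun I J hJ hIJ => (Set.ncard_le_ncard hIJ (Set.toFinite J)).trans hJ)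
    (fun I J hI hJ hIJ => by
      obtain ⟨e, heJ, heI⟩ := Set.exists_mem_notMem_of_ncard_lt_ncard hIJ (Set.toFinite I)
      refine ⟨e, heJ, heI, ?_⟩
      rw [Set.ncard_insert_of_notMem heI (Set.toFinite I)]
      exact (Nat.succ_le_of_lt hIJ).trans hJ)
    (fun I _ => Set.subset_univ I)).matroid

end Matroid

/-! Everything is expressed in the cone sums `h_A = ∑ x_F` over the proper flats `F` which do not
contain `A`. They satisfy straightening relations, by which the products of cone sums indexed by
standard multisets (chains of sets with bounded multiplicities) span the augmented Chow ring.

For their linear independence, consider first the Boolean matroid. The maximal chains of faces can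
be labelled by injective words in `E`, and each word gives a point at which, up to terms of lower
degree, the relations of the ring vanish. The leading forms of the equations of this finite set of
points therefore define a quotient of the ring whose dimension is the number of points. There are
as many standard multisets as injective words, so the spanning set is a basis.

For smaller `d`, multiplication by `h_E ^ (n - d)` maps the ring of `U_{d,n}` to the Boolean one and
carries standard products to standard products. So the Hilbert series of `U_{d,n}` counts standard
multisets, and both sides of the identity satisfy the same recursion, which on the side of the
complex comes from removing the largest flat of a face. -/

open Finset

section OrbitHarmonics

variable {K A B : Type*} [Field K] [CommRing A] [Algebra K A] [CommRing B] [Algebra K B]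

/-- The values under `φ` of the elements of degree smaller than `k` of a graded algebra. For the
evaluation of polynomials at finitely many points, these are the functions on the set of points
which are interpolated by a polynomial of degree smaller than `k`. -/
def lowDegreeImage (𝒜 : ℕ → Submodule K A) (φ : A →ₐ[K] B) (k : ℕ) : Submodule K B :=
  ⨆ j < k, (𝒜 j).map φ.toLinearMap

/-- The ideal of the leading forms of the kernel of `φ`, that is, of the homogeneous elements which
agree with an element of lower degree under `φ`. -/
def leadingIdeal (𝒜 : ℕ → Submodule K A) (φ : A →ₐ[K] B) : Ideal A :=
  Ideal.span {g | ∃ k, g ∈ 𝒜 k ∧ φ g ∈ lowDegreeImage 𝒜 φ k}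

variable {𝒜 : ℕ → Submodule K A} {φ : A →ₐ[K] B}

theorem apply_mem_lowDegreeImage {j k : ℕ} (hjk : j < k) {g : A} (hg : g ∈ 𝒜 j) :
    φ g ∈ lowDegreeImage 𝒜 φ k :=
  Submodule.mem_iSup_of_mem j (Submodule.mem_iSup_of_mem hjk (Submodule.mem_map_of_mem hg))

theorem mem_leadingIdeal {k : ℕ} {g : A} (hg : g ∈ 𝒜 k) (h : φ g ∈ lowDegreeImage 𝒜 φ k) :
    g ∈ leadingIdeal 𝒜 φ :=
  Ideal.subset_span ⟨k, hg, h⟩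

variable [GradedAlgebra 𝒜]

theorem mul_mem_lowDegreeImage {j k : ℕ} {g : A} {b : B} (hg : g ∈ 𝒜 j)
    (hb : b ∈ lowDegreeImage 𝒜 φ k) : φ g * b ∈ lowDegreeImage 𝒜 φ (j + k) := by
  suffices h : lowDegreeImage 𝒜 φ k ≤
      (lowDegreeImage 𝒜 φ (j + k)).comap (LinearMap.mulLeft K (φ g)) from h hb
  refine iSup₂_le fun i hi => Submodule.map_le_iff_le_comap.2 fun f hf => ?_
  simp only [Submodule.mem_comap, LinearMap.mulLeft_apply, AlgHom.toLinearMap_apply, ← map_mul]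
  exact apply_mem_lowDegreeImage (by omega : j + i < j + k) (SetLike.mul_mem_graded hg hf)

theorem apply_decompose_mem_lowDegreeImage {g : A} (hg : g ∈ leadingIdeal 𝒜 φ) (k : ℕ) :
    φ (DirectSum.decompose 𝒜 g k) ∈ lowDegreeImage 𝒜 φ k := by
  refine Submodule.closure_induction
    (p := fun g _ => φ (DirectSum.decompose 𝒜 g k) ∈ lowDegreeImage 𝒜 φ k)
    ?zero (fun f g _ _ hf hg => ?add) (fun c g hg => ?smul) hg
  case zero => simp
  case add =>
    rw [DirectSum.decompose_add, DirectSum.add_apply, Submodule.coe_add, map_add]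
    exact add_mem hf hg
  case smul =>
    obtain ⟨e, hge, hφg⟩ := hg
    rw [smul_eq_mul]
    by_cases hek : e ≤ k
    · rw [DirectSum.coe_decompose_mul_of_right_mem_of_le 𝒜 hge hek, map_mul]
      have hcg := mul_mem_lowDegreeImage (DirectSum.decompose 𝒜 c (k - e)).2 hφg
      rwa [Nat.sub_add_cancel hek] at hcg
    · rw [DirectSum.coe_decompose_mul_of_right_mem_of_not_le 𝒜 hge hek, map_zero]
      exact zero_mem _

theorem apply_mem_lowDegreeImage_of_mem_leadingIdeal {k : ℕ} {g : A} (hg : g ∈ 𝒜 k)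
    (h : g ∈ leadingIdeal 𝒜 φ) : φ g ∈ lowDegreeImage 𝒜 φ k := by
  simpa only [DirectSum.decompose_of_mem_same 𝒜 hg] using apply_decompose_mem_lowDegreeImage h k

variable {ι : Type*} {s : ι → A} {deg : ι → ℕ}

theorem lowDegreeImage_le_span
    (hspan : ∀ k, ∀ g ∈ 𝒜 k, ∃ p ∈ Submodule.span K (s '' {i | deg i = k}),
      g - p ∈ leadingIdeal 𝒜 φ) (hs : ∀ i, s i ∈ 𝒜 (deg i)) (k : ℕ) :
    lowDegreeImage 𝒜 φ k ≤ Submodule.span K ((φ ∘ s) '' {i | deg i < k}) := by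
  induction k using Nat.strong_induction_on with
  | _ k ih =>
  refine iSup₂_le fun j hj => Submodule.map_le_iff_le_comap.2 fun g hg => ?_
  obtain ⟨p, hp, hgp⟩ := hspan j g hg
  have hpj : p ∈ 𝒜 j := by
    refine Submodule.span_le.2 ?_ hp
    rintro _ ⟨i, rfl, rfl⟩
    exact hs i
  have hφp : φ p ∈ Submodule.span K ((φ ∘ s) '' {i | deg i < k}) := by
    have := Submodule.mem_map_of_mem (f := φ.toLinearMap) hp
    rw [Submodule.map_span, ← Set.image_comp] at this
    exact Submodule.span_mono (Set.image_mono fun i hi => lt_of_eq_of_lt hi hj) this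
  have hφgp : φ (g - p) ∈ Submodule.span K ((φ ∘ s) '' {i | deg i < k}) :=
    Submodule.span_mono (Set.image_mono fun i hi => lt_trans hi hj)
      (ih j hj (apply_mem_lowDegreeImage_of_mem_leadingIdeal (sub_mem hg hpj) hgp))
  simpa using add_mem hφgp hφp

theorem span_range_eq_top_of_surjective (hφ : Function.Surjective φ)
    (hs : ∀ i, s i ∈ 𝒜 (deg i))
    (hspan : ∀ k, ∀ g ∈ 𝒜 k, ∃ p ∈ Submodule.span K (s '' {i | deg i = k}),
      g - p ∈ leadingIdeal 𝒜 φ) :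
    Submodule.span K (Set.range (φ ∘ s)) = ⊤ := by
  refine Submodule.eq_top_iff'.2 fun b => ?_
  obtain ⟨g, rfl⟩ := hφ b
  classical
  rw [← DirectSum.sum_support_decompose 𝒜 g, map_sum]
  refine sum_mem fun k _ => Submodule.span_mono (Set.image_subset_range _ {i | deg i < k + 1}) ?_
  exact lowDegreeImage_le_span hspan hs (k + 1)
    (apply_mem_lowDegreeImage k.lt_succ_self (SetLike.coe_mem _))

theorem linearIndependent_mk_leadingIdeal [Fintype ι] (hφ : Function.Surjective φ)
    (hs : ∀ i, s i ∈ 𝒜 (deg i))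
    (hspan : ∀ k, ∀ g ∈ 𝒜 k, ∃ p ∈ Submodule.span K (s '' {i | deg i = k}),
      g - p ∈ leadingIdeal 𝒜 φ)
    (hcard : Fintype.card ι ≤ Module.finrank K B) (k : ℕ) :
    LinearIndependent K fun i : {i // deg i = k} => Ideal.Quotient.mk (leadingIdeal 𝒜 φ) (s i) := by
  have hφs : LinearIndependent K (φ ∘ s) := linearIndependent_of_top_le_span_of_card_le_finrank
    (span_range_eq_top_of_surjective hφ hs hspan).ge hcard
  rw [Fintype.linearIndependent_iff]
  intro c hc
  set p := ∑ i, c i • s i.1 with hp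
  have hpk : p ∈ 𝒜 k := sum_mem fun i _ => Submodule.smul_mem _ _ (by simpa only [i.2] using hs i.1)
  have hpI : p ∈ leadingIdeal 𝒜 φ := by
    rw [← Ideal.Quotient.eq_zero_iff_mem, ← hc, hp, map_sum]
    rfl
  have hφp : φ p = ∑ i, c i • φ (s i.1) := by simp only [hp, map_sum, map_smul]
  have hmem : φ p ∈ Submodule.span K ((φ ∘ s) '' {i | deg i = k}) := by
    rw [hφp]
    exact sum_mem fun i _ => Submodule.smul_mem _ _ (Submodule.subset_span ⟨i.1, i.2, rfl⟩)
  have hdisj := hφs.disjoint_span_image (s := {i | deg i = k}) (t := {i | deg i < k})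
    (Set.disjoint_left.2 fun i hi hi' => hi'.ne hi)
  have hzero : φ p = 0 := Submodule.disjoint_def.1 hdisj _ hmem
    (lowDegreeImage_le_span hspan hs k (apply_mem_lowDegreeImage_of_mem_leadingIdeal hpk hpI))
  exact Fintype.linearIndependent_iff.1 (hφs.comp _ Subtype.val_injective) c (hφp.symm.trans hzero)

end OrbitHarmonics

section Evaluation

variable {K σ ι : Type*} [Field K] [Finite ι]

theorem aeval_surjective_of_injective {v : ι → σ → K} (hv : Function.Injective v) :
    Function.Surjective (MvPolynomial.aeval (R := K) fun s i => v i s) := by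
  classical
  have := Fintype.ofFinite ι
  have single_mem (i : ι) :
      Pi.single i (1 : K) ∈ (MvPolynomial.aeval (R := K) fun s i => v i s).range := by
    choose s hs using fun j : {j // j ≠ i} => Function.ne_iff.1 (hv.ne j.2)
    refine (AlgHom.mem_range _).2 ⟨∏ j, MvPolynomial.C (v i (s j) - v j (s j))⁻¹ *
      (MvPolynomial.X (s j) - MvPolynomial.C (v j (s j))), funext fun l => ?_⟩
    simp only [map_prod, map_mul, map_sub, MvPolynomial.aeval_X,
      MvPolynomial.algHom_C, Finset.prod_apply, Pi.mul_apply, Pi.sub_apply, Pi.algebraMap_apply,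
      Algebra.algebraMap_self, RingHom.id_apply]
    by_cases hl : l = i
    · subst hl
      rw [Pi.single_eq_same]
      exact prod_eq_one fun j _ => inv_mul_cancel₀ (sub_ne_zero.2 (hs j).symm)
    · rw [Pi.single_eq_of_ne hl]
      exact prod_eq_zero (mem_univ ⟨l, hl⟩) (by rw [sub_self, mul_zero])
  rw [← AlgHom.range_eq_top, eq_top_iff]
  intro f _
  rw [← Finset.univ_sum_single f]
  refine sum_mem fun i _ => ?_
  rw [← mul_one (f i), ← smul_eq_mul, Pi.single_smul]
  exact Subalgebra.smul_mem _ (single_mem i) (f i)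

end Evaluation

section StandardMultisets

variable {α : Type*}

/-- Multisets of non-empty sets which form a chain with largest member `G` (or are empty, if `G`
is), such that the first member has at most the multiplicity of its size, and every other member
has a multiplicity smaller than the gap to its predecessor. -/
inductive IsNested : Finset α → Multiset (Finset α) → Prop
  | start (G : Finset α) : IsNested G (Multiset.replicate G.card G)
  | step {G' G : Finset α} {τ : Multiset (Finset α)} {a : ℕ} : IsNested G' τ → G' ⊂ G → 0 < a →
      G'.card + a < G.card → IsNested G (τ + Multiset.replicate a G)

theorem IsNested.subset_of_mem {G : Finset α} {τ : Multiset (Finset α)} (h : IsNested G τ) :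
    ∀ A ∈ τ, A ⊆ G := by
  induction h with
  | start G => intro A hA; rw [Multiset.eq_of_mem_replicate hA]
  | step _ hG _ _ ih =>
    intro A hA
    rcases Multiset.mem_add.1 hA with hA | hA
    · exact (ih A hA).trans hG.1
    · rw [Multiset.eq_of_mem_replicate hA]

/-- The multisets which index the monomial basis of the augmented Chow ring of the uniform matroid
of rank `d` on `α`. -/
def IsStandard [Fintype α] (d : ℕ) (τ : Multiset (Finset α)) : Prop :=
  τ = Multiset.replicate d univ ∨
    ∃ G τ' a, IsNested G τ' ∧ G.card + a < d ∧ τ = τ' + Multiset.replicate a univ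

theorem IsStandard.add_replicate_univ [Fintype α] {d : ℕ} {τ : Multiset (Finset α)}
    (h : IsStandard d τ) (m : ℕ) : IsStandard (d + m) (τ + Multiset.replicate m univ) := by
  rcases h with rfl | ⟨G, τ', a, hτ', ha, rfl⟩
  · exact .inl (Multiset.replicate_add d m univ).symm
  · refine .inr ⟨G, τ', a + m, hτ', by omega, ?_⟩
    rw [Multiset.replicate_add, add_assoc]

theorem isNested_replicate {G : Finset α} {a : ℕ} (ha : 0 < a) (haG : a ≤ G.card) :
    IsNested G (Multiset.replicate a G) := by
  rcases haG.eq_or_lt with rfl | h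
  · exact .start G
  · have hG : ∅ ⊂ G := empty_ssubset.2 (card_pos.1 (ha.trans h))
    simpa using (IsNested.start ∅).step hG ha (by simpa using h)

variable [DecidableEq α]

/-- Multisets of non-empty sets which form a chain and whose multiplicities are bounded by the size
of the set and smaller than the gap to each smaller member: those among the multisets of non-empty
sets which none of the straightening relations of the augmented Chow ring of a Boolean matroid
rewrites. -/
structure HasSmallMultiplicities (τ : Multiset (Finset α)) : Prop where
  empty_notMem : ∅ ∉ τ
  chain : ∀ A ∈ τ, ∀ B ∈ τ, A ⊆ B ∨ B ⊆ A
  count_le_card : ∀ A ∈ τ, τ.count A ≤ A.card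
  card_add_count_lt : ∀ A ∈ τ, ∀ B ∈ τ, A ⊂ B → A.card + τ.count B < B.card

theorem sup_mem_of_chain {τ : Multiset (Finset α)} (h0 : τ ≠ 0)
    (hc : ∀ A ∈ τ, ∀ B ∈ τ, A ⊆ B ∨ B ⊆ A) : τ.sup ∈ τ := by
  induction τ using Multiset.induction_on with
  | empty => exact absurd rfl h0
  | cons A τ ih =>
    rw [Multiset.sup_cons]
    by_cases hτ : τ = 0
    · simp [hτ]
    have hsup := ih hτ fun A hA B hB =>
      hc A (Multiset.mem_cons_of_mem hA) B (Multiset.mem_cons_of_mem hB)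
    rcases hc A (Multiset.mem_cons_self _ _) _ (Multiset.mem_cons_of_mem hsup) with h | h
    · rw [sup_eq_right.2 h]
      exact Multiset.mem_cons_of_mem hsup
    · rw [sup_eq_left.2 h]
      exact Multiset.mem_cons_self _ _

theorem filter_ne_add_replicate_count {β : Type*} [DecidableEq β] (τ : Multiset β) (b : β) :
    τ.filter (· ≠ b) + Multiset.replicate (τ.count b) b = τ := by
  rw [← Multiset.filter_eq', add_comm]
  exact Multiset.filter_add_not (· = b) τ

namespace HasSmallMultiplicities

variable {σ τ : Multiset (Finset α)}

theorem mono (h : HasSmallMultiplicities τ) (hσ : σ ≤ τ) : HasSmallMultiplicities σ where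
  empty_notMem h0 := h.empty_notMem (Multiset.mem_of_le hσ h0)
  chain A hA B hB := h.chain A (Multiset.mem_of_le hσ hA) B (Multiset.mem_of_le hσ hB)
  count_le_card A hA :=
    (Multiset.count_le_of_le A hσ).trans (h.count_le_card A (Multiset.mem_of_le hσ hA))
  card_add_count_lt A hA B hB hAB :=
    (Nat.add_le_add_left (Multiset.count_le_of_le B hσ) _).trans_lt
      (h.card_add_count_lt A (Multiset.mem_of_le hσ hA) B (Multiset.mem_of_le hσ hB) hAB)

theorem isNested_sup (h : HasSmallMultiplicities τ) : IsNested τ.sup τ := by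
  induction hn : τ.card using Nat.strong_induction_on generalizing τ with
  | _ n ih =>
  rcases eq_or_ne τ 0 with rfl | hτ
  · exact IsNested.start ∅
  set G := τ.sup
  have hGτ : G ∈ τ := sup_mem_of_chain hτ h.chain
  have hpos : 0 < τ.count G := Multiset.count_pos.2 hGτ
  set σ := τ.filter (· ≠ G) with hσ
  have hdec : σ + Multiset.replicate (τ.count G) G = τ := filter_ne_add_replicate_count τ G
  have hσg : HasSmallMultiplicities σ := h.mono (Multiset.filter_le _ _)
  rcases eq_or_ne σ 0 with hσ0 | hσ0
  · rw [← hdec, hσ0, zero_add]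
    exact isNested_replicate hpos (h.count_le_card G hGτ)
  · obtain ⟨hmem, hne⟩ := Multiset.mem_filter.1 (hσ ▸ sup_mem_of_chain hσ0 hσg.chain)
    have hlt : σ.sup ⊂ G := (Multiset.le_sup hmem).lt_of_ne hne
    have hcard : σ.card < n := by
      rw [← hn, ← congrArg Multiset.card hdec, Multiset.card_add, Multiset.card_replicate]
      omega
    rw [← hdec]
    exact (ih _ hcard hσg rfl).step hlt hpos (h.card_add_count_lt _ hmem _ hGτ hlt)

theorem isStandard [Fintype α] {d : ℕ} (h : HasSmallMultiplicities τ) (hd : τ.count univ ≤ d)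
    (hlt : ∀ A ∈ τ, A ≠ univ → A.card + τ.count univ < d) : IsStandard d τ := by
  set σ := τ.filter (· ≠ univ) with hσ
  have hdec : σ + Multiset.replicate (τ.count univ) univ = τ :=
    filter_ne_add_replicate_count τ univ
  have hσg : HasSmallMultiplicities σ := h.mono (Multiset.filter_le _ _)
  rcases eq_or_ne σ 0 with hσ0 | hσ0
  · rw [hσ0, zero_add] at hdec
    rcases hd.eq_or_lt with hd | hd
    · exact .inl (hd ▸ hdec.symm)
    · exact .inr ⟨∅, 0, τ.count univ, .start ∅, by simpa using hd, by rw [zero_add, hdec]⟩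
  · obtain ⟨hmem, hne⟩ := Multiset.mem_filter.1 (hσ ▸ sup_mem_of_chain hσ0 hσg.chain)
    exact .inr ⟨σ.sup, σ, τ.count univ, hσg.isNested_sup, hlt _ hmem hne, hdec.symm⟩

end HasSmallMultiplicities

end StandardMultisets

section ConeSums

variable {α : Type*} [Fintype α] [DecidableEq α]

/-- The sum of the `x F` over all `F` which do not contain `A`. In the augmented Chow ring of a
matroid this is the class of the simplicial generator which belongs to `A`. -/
def coneSum {C : Type*} [AddCommMonoid C] (x : Finset α → C) (A : Finset α) : C :=
  ∑ F with ¬ A ⊆ F, x F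

theorem coneSum_empty {C : Type*} [AddCommMonoid C] (x : Finset α → C) : coneSum x ∅ = 0 := by
  simp [coneSum]

theorem map_coneSum {C D G : Type*} [AddCommMonoid C] [AddCommMonoid D] [FunLike G C D]
    [AddMonoidHomClass G C D] (f : G) (x : Finset α → C) (A : Finset α) :
    f (coneSum x A) = coneSum (fun F => f (x F)) A :=
  map_sum f _ _

theorem coneSum_sub {C : Type*} [AddCommGroup C] (x : Finset α → C) {A B : Finset α} (h : A ⊆ B) :
    coneSum x B - coneSum x A = ∑ F with A ⊆ F ∧ ¬ B ⊆ F, x F := by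
  rw [sub_eq_iff_eq_add, coneSum, coneSum,
    ← sum_filter_add_sum_filter_not (univ.filter fun F => ¬ B ⊆ F) (fun F => A ⊆ F),
    filter_filter, filter_filter]
  congr 1
  · exact sum_congr (by ext F; simp [and_comm]) fun _ _ => rfl
  · refine sum_congr ?_ fun _ _ => rfl
    ext F
    simp only [mem_filter, mem_univ, true_and]
    exact ⟨fun hF => hF.2, fun hF => ⟨fun hB => hF (h.trans hB), hF⟩⟩

theorem mem_span_range_coneSum {R C : Type*} [Ring R] [AddCommGroup C] [Module R C]
    {x : Finset α → C} (hx : x univ = 0) (F : Finset α) :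
    x F ∈ Submodule.span R (Set.range (coneSum x)) := by
  induction F using WellFoundedGT.induction with
  | _ F ih =>
  rcases eq_or_ne F univ with rfl | hF
  · rw [hx]
    exact zero_mem _
  have hsum : x F + ∑ K with F ⊂ K ∧ ¬ univ ⊆ K, x K = coneSum x univ - coneSum x F := by
    rw [coneSum_sub x (subset_univ F), ← sum_insert (by simp)]
    refine sum_congr ?_ fun _ _ => rfl
    ext K
    have : univ ⊆ F ↔ F = univ := univ_subset_iff
    rcases eq_or_ne K F with rfl | hKF <;>
      simp_all [ssubset_iff_subset_ne, eq_comm]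
  rw [← add_sub_cancel_right (x F) (∑ K with F ⊂ K ∧ ¬ univ ⊆ K, x K), hsum]
  refine sub_mem (sub_mem (Submodule.subset_span ⟨univ, rfl⟩) (Submodule.subset_span ⟨F, rfl⟩)) ?_
  exact sum_mem fun K hK => ih K (mem_filter.1 hK).2.1

/-- The product of the cone sums of the members of `τ`. -/
def coneMonomial {C : Type*} [CommSemiring C] (x : Finset α → C) (τ : Multiset (Finset α)) : C :=
  (τ.map (coneSum x)).prod

section CommSemiring

variable {C : Type*} [CommSemiring C] (x : Finset α → C)

theorem coneMonomial_zero : coneMonomial x 0 = 1 := rfl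

theorem coneMonomial_cons (A : Finset α) (τ : Multiset (Finset α)) :
    coneMonomial x (A ::ₘ τ) = coneSum x A * coneMonomial x τ := by
  rw [coneMonomial, Multiset.map_cons, Multiset.prod_cons, coneMonomial]

theorem coneMonomial_add (σ τ : Multiset (Finset α)) :
    coneMonomial x (σ + τ) = coneMonomial x σ * coneMonomial x τ := by
  rw [coneMonomial, Multiset.map_add, Multiset.prod_add, coneMonomial, coneMonomial]

theorem coneMonomial_replicate (k : ℕ) (A : Finset α) :
    coneMonomial x (Multiset.replicate k A) = coneSum x A ^ k := by
  rw [coneMonomial, Multiset.map_replicate, Multiset.prod_replicate]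

theorem map_coneMonomial {D G : Type*} [CommSemiring D] [FunLike G C D] [RingHomClass G C D]
    (f : G) (τ : Multiset (Finset α)) :
    f (coneMonomial x τ) = coneMonomial (fun F => f (x F)) τ := by
  simp only [coneMonomial, map_multiset_prod, Multiset.map_map, Function.comp_def, map_coneSum]

theorem span_range_coneSum_pow_le (R : Type*) [CommSemiring R] [Algebra R C] (k : ℕ) :
    Submodule.span R (Set.range (coneSum x)) ^ k ≤
      Submodule.span R (coneMonomial x '' {τ | τ.card = k}) := by
  induction k with
  | zero =>
    rw [pow_zero, Submodule.one_le]
    exact Submodule.subset_span ⟨0, Multiset.card_zero, coneMonomial_zero x⟩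
  | succ k ih =>
    rw [pow_succ']
    refine (mul_le_mul_right ih _).trans ?_
    rw [Submodule.span_mul_span, Submodule.span_le]
    rintro _ ⟨_, ⟨A, rfl⟩, _, ⟨τ, rfl, rfl⟩, rfl⟩
    exact Submodule.subset_span ⟨A ::ₘ τ, Multiset.card_cons A τ, coneMonomial_cons x A τ⟩

end CommSemiring

section IsHomogeneous

variable {R σ : Type*} [CommSemiring R] {p : Finset α → MvPolynomial σ R}

theorem isHomogeneous_coneSum (hp : ∀ F, (p F).IsHomogeneous 1) (A : Finset α) :
    (coneSum p A).IsHomogeneous 1 :=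
  MvPolynomial.IsHomogeneous.sum _ _ _ fun F _ => hp F

theorem isHomogeneous_coneMonomial (hp : ∀ F, (p F).IsHomogeneous 1)
    (τ : Multiset (Finset α)) : (coneMonomial p τ).IsHomogeneous τ.card := by
  induction τ using Multiset.induction_on with
  | empty => exact MvPolynomial.isHomogeneous_one σ R
  | cons A τ ih =>
    rw [coneMonomial_cons, Multiset.card_cons, add_comm]
    exact (isHomogeneous_coneSum hp A).mul ih

end IsHomogeneous

end ConeSums

section Relations

variable {α : Type*} [DecidableEq α] [Fintype α] {C : Type*} [CommRing C]

/-- The relations of the augmented Chow ring of the uniform matroid of rank `d` on `α`, for a family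
`x` indexed by all subsets of `α` which vanishes outside of the proper flats. -/
structure AugChowRelations (d : ℕ) (x : Finset α → C) (y : α → C) : Prop where
  eq_zero_of_le_card : ∀ F : Finset α, d ≤ F.card → x F = 0
  eq_sum : ∀ i, y i = ∑ F with i ∉ F, x F
  mul_eq_zero_of_not_subset : ∀ F G, ¬ F ⊆ G → ¬ G ⊆ F → x F * x G = 0
  mul_eq_zero_of_notMem : ∀ i F, i ∉ F → y i * x F = 0

namespace AugChowRelations

variable {d : ℕ} {x : Finset α → C} {y : α → C}

theorem univ_eq_zero (r : AugChowRelations d x y) (hd : d ≤ Fintype.card α) : x univ = 0 :=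
  r.eq_zero_of_le_card univ hd

theorem coneSum_singleton (r : AugChowRelations d x y) (i : α) : coneSum x {i} = y i := by
  simp only [r.eq_sum, coneSum, singleton_subset_iff]

theorem coneSum_eq_sum (r : AugChowRelations d x y) {A : Finset α} (hA : d ≤ A.card) :
    coneSum x A = ∑ F, x F := by
  rw [coneSum, ← sum_filter_add_sum_filter_not univ (A ⊆ ·), right_eq_add]
  exact sum_eq_zero fun F hF =>
    r.eq_zero_of_le_card F (hA.trans (card_le_card (mem_filter.1 hF).2))

theorem coneSum_eq_coneSum_univ (r : AugChowRelations d x y) {A : Finset α} (hA : d ≤ A.card) :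
    coneSum x A = coneSum x univ := by
  rw [r.coneSum_eq_sum hA, r.coneSum_eq_sum (hA.trans (card_le_univ A))]

theorem coneSum_sub_mul_coneSum_sub (r : AugChowRelations d x y) (F G : Finset α) :
    (coneSum x F - coneSum x (F ∪ G)) * (coneSum x G - coneSum x (F ∪ G)) = 0 := by
  rw [← neg_sub, ← neg_sub (coneSum x (F ∪ G)) (coneSum x G), neg_mul_neg,
    coneSum_sub x subset_union_left, coneSum_sub x subset_union_right, sum_mul_sum]
  refine sum_eq_zero fun K hK => sum_eq_zero fun L hL => ?_
  simp only [mem_filter, mem_univ, true_and, union_subset_iff, not_and] at hK hL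
  exact r.mul_eq_zero_of_not_subset K L (fun h => hL.2 (hK.1.trans h) hL.1)
    fun h => hK.2 hK.1 (hL.1.trans h)

theorem mul_coneSum_insert (r : AugChowRelations d x y) {i : α} {G K : Finset α}
    (hGK : G ⊆ K) (hi : i ∉ K) : x K * coneSum x (insert i G) = 0 := by
  have hsum : coneSum x (insert i G) = y i + ∑ F with i ∈ F ∧ ¬ insert i G ⊆ F, x F := by
    rw [← r.coneSum_singleton, ← sub_eq_iff_eq_add', coneSum_sub x (by simp)]
    simp only [singleton_subset_iff]
  rw [hsum, mul_add, mul_comm, r.mul_eq_zero_of_notMem i K hi, zero_add, mul_sum]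
  refine sum_eq_zero fun F hF => ?_
  simp only [mem_filter, mem_univ, true_and] at hF
  exact r.mul_eq_zero_of_not_subset K F (fun h => hF.2 (insert_subset hF.1 (hGK.trans h)))
    fun h => hi (h hF.1)

theorem coneSum_insert_sq (r : AugChowRelations d x y) (i : α) (G : Finset α) :
    coneSum x (insert i G) ^ 2 = coneSum x (insert i G) * coneSum x G := by
  rw [sq, ← sub_eq_zero, ← mul_sub, coneSum_sub x (subset_insert i G), mul_sum]
  refine sum_eq_zero fun K hK => ?_
  simp only [mem_filter, mem_univ, true_and] at hK
  rw [mul_comm]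
  exact r.mul_coneSum_insert hK.1 fun h => hK.2 (insert_subset h hK.1)

theorem coneSum_insert_pow (r : AugChowRelations d x y) (i : α) (G : Finset α) (m : ℕ) :
    coneSum x (insert i G) ^ (m + 1) = coneSum x (insert i G) * coneSum x G ^ m := by
  induction m with
  | zero => simp
  | succ m ih =>
    rw [pow_succ, ih]
    linear_combination coneSum x G ^ m * r.coneSum_insert_sq i G

theorem coneSum_pow_card_add_one (r : AugChowRelations d x y) (G : Finset α) :
    coneSum x G ^ (G.card + 1) = 0 := by
  induction G using Finset.induction_on with
  | empty => simp [coneSum_empty]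
  | insert i G hi ih => rw [card_insert_of_notMem hi, r.coneSum_insert_pow, ih, mul_zero]

theorem coneSum_mul_coneSum_pow (r : AugChowRelations d x y) {F G : Finset α} (h : F ⊆ G) {m : ℕ}
    (hm : F.card + m = G.card) : coneSum x F * coneSum x G ^ m = coneSum x G ^ (m + 1) := by
  induction m generalizing G with
  | zero =>
    rw [eq_of_subset_of_card_le h hm.ge, pow_zero, mul_one, pow_one]
  | succ m ih =>
    obtain ⟨i, hi, hiF⟩ := exists_of_ssubset (h.ssubset_of_ne fun e => by subst e; omega)
    have hF := ih (G := G.erase i) (subset_erase.2 ⟨h, hiF⟩) (by rw [card_erase_of_mem hi]; omega)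
    rw [← insert_erase hi, r.coneSum_insert_pow, r.coneSum_insert_pow, ← hF]
    ring

theorem coneSum_pow_min_add_one (r : AugChowRelations d x y) (G : Finset α) :
    coneSum x G ^ (min G.card d + 1) = 0 := by
  rcases le_total G.card d with h | h
  · rw [min_eq_left h, r.coneSum_pow_card_add_one]
  · obtain ⟨G', -, rfl⟩ := exists_subset_card_eq h
    rw [min_eq_right h, r.coneSum_eq_coneSum_univ h, ← r.coneSum_eq_coneSum_univ le_rfl,
      r.coneSum_pow_card_add_one]

theorem coneSum_mul_coneSum_pow_min (r : AugChowRelations d x y) {F G : Finset α} (hFG : F ⊂ G)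
    (hF : F.card < d) : coneSum x F * coneSum x G ^ (min G.card d - F.card) =
      coneSum x G ^ (min G.card d - F.card + 1) := by
  have hlt := card_lt_card hFG
  rcases le_total G.card d with h | h
  · rw [min_eq_left h, r.coneSum_mul_coneSum_pow hFG.1 (by omega)]
  · obtain ⟨G', hFG', -, hG'⟩ := exists_subsuperset_card_eq hFG.1 hF.le h
    rw [min_eq_right h, r.coneSum_eq_coneSum_univ h, ← r.coneSum_eq_coneSum_univ hG'.ge,
      r.coneSum_mul_coneSum_pow hFG' (by omega)]

end AugChowRelations

end Relations

section Straightening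

theorem aeval_mem_pow_of_isHomogeneous {R C σ : Type*} [CommSemiring R] [CommSemiring C]
    [Algebra R C] {V : Submodule R C} {f : σ → C} (hf : ∀ i, f i ∈ V) {k : ℕ}
    {p : MvPolynomial σ R} (hp : p.IsHomogeneous k) : MvPolynomial.aeval f p ∈ V ^ k := by
  rw [MvPolynomial.aeval_def, MvPolynomial.eval₂_eq]
  refine sum_mem fun m hm => ?_
  rw [← Algebra.smul_def, ← hp (MvPolynomial.mem_support_iff.1 hm), Finsupp.weight_apply]
  exact Submodule.smul_mem _ _ (SetLike.prod_pow_mem_graded (V ^ ·) _ _ _ fun i _ =>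
    (pow_one V).symm ▸ hf i)

variable {α : Type*} [Fintype α]

/-- The sum of the sizes of the complements of the members of `τ`, which every straightening step
decreases. -/
def coWeight (τ : Multiset (Finset α)) : ℕ :=
  (τ.map fun A => Fintype.card α - A.card).sum

theorem coWeight_cons (A : Finset α) (τ : Multiset (Finset α)) :
    coWeight (A ::ₘ τ) = Fintype.card α - A.card + coWeight τ := by
  rw [coWeight, Multiset.map_cons, Multiset.sum_cons, coWeight]

theorem coWeight_cons_lt {A B : Finset α} (h : A ⊂ B) (τ : Multiset (Finset α)) :
    coWeight (B ::ₘ τ) < coWeight (A ::ₘ τ) := by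
  have hAB := card_lt_card h
  have hB := card_le_univ B
  rw [coWeight_cons, coWeight_cons]
  omega

variable [DecidableEq α] {C : Type*} [CommRing C]

/-- The span of the cone monomials of the same degree as that of `τ` and of smaller co-weight. -/
def lowerSpan (R : Type*) [CommRing R] [Algebra R C] (x : Finset α → C)
    (τ : Multiset (Finset α)) : Submodule R C :=
  Submodule.span R (coneMonomial x '' {σ | σ.card = τ.card ∧ coWeight σ < coWeight τ})

variable {R : Type*} [CommRing R] [Algebra R C] {d : ℕ} {x : Finset α → C} {y : α → C}
  {τ : Multiset (Finset α)}

theorem coneMonomial_mem_lowerSpan {σ : Multiset (Finset α)} (hcard : σ.card = τ.card)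
    (hlt : coWeight σ < coWeight τ) : coneMonomial x σ ∈ lowerSpan R x τ :=
  Submodule.subset_span ⟨σ, ⟨hcard, hlt⟩, rfl⟩

theorem coneMonomial_mem_lowerSpan_of_empty_mem (h : ∅ ∈ τ) :
    coneMonomial x τ ∈ lowerSpan R x τ := by
  obtain ⟨τ, rfl⟩ := Multiset.exists_cons_of_mem h
  rw [coneMonomial_cons, coneSum_empty, zero_mul]
  exact zero_mem _

namespace AugChowRelations

theorem coneMonomial_mem_lowerSpan_of_le_card (r : AugChowRelations d x y) {A : Finset α}
    (hA : A ∈ τ) (hd : d ≤ A.card) (hne : A ≠ univ) :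
    coneMonomial x τ ∈ lowerSpan R x τ := by
  obtain ⟨τ, rfl⟩ := Multiset.exists_cons_of_mem hA
  rw [coneMonomial_cons, r.coneSum_eq_coneSum_univ hd, ← coneMonomial_cons]
  refine coneMonomial_mem_lowerSpan ?_ (coWeight_cons_lt (ssubset_univ_iff.2 hne) τ)
  rw [Multiset.card_cons, Multiset.card_cons]

theorem coneMonomial_mem_lowerSpan_of_not_subset (r : AugChowRelations d x y) {F G : Finset α}
    (hF : F ∈ τ) (hG : G ∈ τ) (hFG : ¬ F ⊆ G) (hGF : ¬ G ⊆ F) :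
    coneMonomial x τ ∈ lowerSpan R x τ := by
  obtain ⟨τ, rfl⟩ := Multiset.exists_cons_of_mem hF
  obtain ⟨τ, rfl⟩ := Multiset.exists_cons_of_mem
    ((Multiset.mem_cons.1 hG).resolve_left fun h => hFG h.ge)
  have hF_lt : F.card < (F ∪ G).card :=
    card_lt_card ⟨subset_union_left, fun h => hGF (subset_union_right.trans h)⟩
  have hG_lt : G.card < (F ∪ G).card :=
    card_lt_card ⟨subset_union_right, fun h => hFG (subset_union_left.trans h)⟩
  have h_le := card_le_univ (F ∪ G)
  have hrel : coneMonomial x (F ::ₘ G ::ₘ τ) = coneMonomial x ((F ∪ G) ::ₘ F ::ₘ τ) +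
      coneMonomial x ((F ∪ G) ::ₘ G ::ₘ τ) - coneMonomial x ((F ∪ G) ::ₘ (F ∪ G) ::ₘ τ) := by
    simp only [coneMonomial_cons]
    linear_combination coneMonomial x τ * r.coneSum_sub_mul_coneSum_sub F G
  rw [hrel]
  refine sub_mem (add_mem ?_ ?_) ?_ <;>
    exact coneMonomial_mem_lowerSpan (by simp only [Multiset.card_cons])
      (by simp only [coWeight_cons]; omega)

theorem coneMonomial_mem_lowerSpan_of_lt_count (r : AugChowRelations d x y) {G : Finset α}
    (hG : min G.card d < τ.count G) : coneMonomial x τ ∈ lowerSpan R x τ := by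
  obtain ⟨σ, rfl⟩ := Multiset.le_iff_exists_add.1 (Multiset.le_count_iff_replicate_le.1 hG)
  rw [coneMonomial_add, coneMonomial_replicate, Nat.succ_eq_add_one, r.coneSum_pow_min_add_one,
    zero_mul]
  exact zero_mem _

theorem coneMonomial_mem_lowerSpan_of_ssubset (r : AugChowRelations d x y) {F G : Finset α}
    (hF : F ∈ τ) (hFG : F ⊂ G) (hd : F.card < d) (hle : min G.card d ≤ F.card + τ.count G) :
    coneMonomial x τ ∈ lowerSpan R x τ := by
  obtain ⟨σ, rfl⟩ := Multiset.exists_cons_of_mem hF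
  rw [Multiset.count_cons_of_ne hFG.ne'] at hle
  obtain ⟨ρ, rfl⟩ := Multiset.le_iff_exists_add.1
    (Multiset.le_count_iff_replicate_le.1 (Nat.sub_le_iff_le_add'.2 hle))
  have hrel : coneMonomial x (F ::ₘ (Multiset.replicate (min G.card d - F.card) G + ρ)) =
      coneMonomial x (G ::ₘ (Multiset.replicate (min G.card d - F.card) G + ρ)) := by
    simp only [coneMonomial_cons, coneMonomial_add, coneMonomial_replicate]
    linear_combination coneMonomial x ρ * r.coneSum_mul_coneSum_pow_min hFG hd
  rw [hrel]
  refine coneMonomial_mem_lowerSpan ?_ (coWeight_cons_lt hFG _)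
  rw [Multiset.card_cons, Multiset.card_cons]

theorem coneMonomial_mem_lowerSpan_of_not_isStandard (r : AugChowRelations d x y)
    (hτ : ¬ IsStandard d τ) : coneMonomial x τ ∈ lowerSpan R x τ := by
  contrapose! hτ with hred
  have hlarge : ∀ A ∈ τ, A ≠ univ → A.card < d := fun A hA hne => not_le.1 fun hd =>
    hred (r.coneMonomial_mem_lowerSpan_of_le_card hA hd hne)
  have hcount : ∀ A, τ.count A ≤ min A.card d := fun A =>
    not_lt.1 fun h => hred (r.coneMonomial_mem_lowerSpan_of_lt_count h)
  have hgap : ∀ A ∈ τ, ∀ B, A ⊂ B → A.card + τ.count B < min B.card d := fun A hA B hAB =>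
    not_le.1 fun h => hred (r.coneMonomial_mem_lowerSpan_of_ssubset hA hAB
      (hlarge A hA (hAB.trans_le (subset_univ B)).ne) h)
  have hsmall : HasSmallMultiplicities τ :=
    { empty_notMem := fun h => hred (coneMonomial_mem_lowerSpan_of_empty_mem h)
      chain := fun A hA B hB => or_iff_not_imp_left.2 fun hAB => not_not.1 fun hBA =>
        hred (r.coneMonomial_mem_lowerSpan_of_not_subset hA hB hAB hBA)
      count_le_card := fun A _ => (hcount A).trans (min_le_left _ _)
      card_add_count_lt := fun A hA B _ hAB => (hgap A hA B hAB).trans_le (min_le_left _ _) }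
  exact hsmall.isStandard ((hcount univ).trans (min_le_right _ _)) fun A hA hne =>
    (hgap A hA univ (ssubset_univ_iff.2 hne)).trans_le (min_le_right _ _)

theorem coneMonomial_mem_span_isStandard (r : AugChowRelations d x y)
    (τ : Multiset (Finset α)) : coneMonomial x τ ∈
      Submodule.span R (coneMonomial x '' {σ | IsStandard d σ ∧ σ.card = τ.card}) := by
  induction hn : coWeight τ using Nat.strong_induction_on generalizing τ with
  | _ n ih =>
  by_cases hτ : IsStandard d τ
  · exact Submodule.subset_span ⟨τ, ⟨hτ, rfl⟩, rfl⟩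
  · refine Submodule.span_le.2 ?_ (r.coneMonomial_mem_lowerSpan_of_not_isStandard hτ)
    rintro _ ⟨σ, ⟨hcard, hlt⟩, rfl⟩
    simpa only [SetLike.mem_coe, hcard] using ih _ (hn ▸ hlt) σ rfl

theorem aeval_mem_span_isStandard (r : AugChowRelations d x y) {σ : Type*} {f : σ → C}
    (hf : ∀ i, f i ∈ Submodule.span R (Set.range (coneSum x))) {k : ℕ} {p : MvPolynomial σ R}
    (hp : p.IsHomogeneous k) : MvPolynomial.aeval f p ∈
      Submodule.span R (coneMonomial x '' {τ | IsStandard d τ ∧ τ.card = k}) := by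
  have hpow := aeval_mem_pow_of_isHomogeneous hf hp
  refine Submodule.span_le.2 ?_ (span_range_coneSum_pow_le x R k hpow)
  rintro _ ⟨τ, rfl, rfl⟩
  exact r.coneMonomial_mem_span_isStandard τ

end AugChowRelations

end Straightening

section Counting

variable {α : Type*}

theorem finite_multiset_card_le {β : Type*} [Finite β] (m : ℕ) :
    {s : Multiset β | s.card ≤ m}.Finite := by
  have : {s : Multiset β | s.card ≤ m} ⊆
      ⋃ k ∈ Set.Iic m, Set.range (fun s : Sym β k => (s : Multiset β)) := by
    intro s hs
    exact Set.mem_biUnion (x := s.card) hs ⟨⟨s, rfl⟩, rfl⟩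
  exact ((Set.finite_Iic m).biUnion fun k _ => Set.finite_range _).subset this

theorem IsNested.card_le {G : Finset α} {τ : Multiset (Finset α)} (h : IsNested G τ) :
    τ.card ≤ G.card := by
  induction h with
  | start G => simp
  | step h hG ha hab ih => rw [Multiset.card_add, Multiset.card_replicate]; omega

theorem finite_isNested [Finite α] (G : Finset α) : {τ | IsNested G τ}.Finite :=
  (finite_multiset_card_le G.card).subset fun _ h => h.card_le

/-- The finite set of all nested multisets with largest member `G`. -/
noncomputable def nestedFinset [Fintype α] (G : Finset α) : Finset (Multiset (Finset α)) :=
  (finite_isNested G).toFinset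

theorem mem_nestedFinset [Fintype α] {G : Finset α} {τ : Multiset (Finset α)} :
    τ ∈ nestedFinset G ↔ IsNested G τ := Set.Finite.mem_toFinset _

theorem finite_isStandard [Fintype α] (d : ℕ) :
    {τ : Multiset (Finset α) | IsStandard d τ}.Finite := by
  refine (finite_multiset_card_le d).subset ?_
  rintro _ (rfl | ⟨G, τ, a, h, ha, rfl⟩)
  · simp
  · have := h.card_le
    simp only [Set.mem_ofPred_eq, Multiset.card_add, Multiset.card_replicate]
    omega

/-- The finite set of all standard multisets. -/
noncomputable def standardFinset (α : Type*) [Fintype α] (d : ℕ) :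
    Finset (Multiset (Finset α)) :=
  (finite_isStandard (α := α) d).toFinset

theorem mem_standardFinset [Fintype α] {d : ℕ} {τ : Multiset (Finset α)} :
    τ ∈ standardFinset α d ↔ IsStandard d τ := Set.Finite.mem_toFinset _

theorem sum_card_lt {M : Type*} [AddCommMonoid M] (T : Finset α) (d : ℕ) (f : ℕ → M) :
    ∑ G ∈ T.powerset with G.card < d, f G.card = ∑ m ∈ range d, T.card.choose m • f m := by
  rw [← sum_fiberwise_of_maps_to (g := card) (t := range d) fun G hG =>
    mem_range.2 (mem_filter.1 hG).2]
  refine sum_congr rfl fun m hm => ?_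
  rw [sum_congr rfl fun G hG => by rw [(mem_filter.1 hG).2], sum_const, ← card_powersetCard]
  congr 2
  ext G
  have := mem_range.1 hm
  simp only [mem_filter, mem_powerset, mem_powersetCard]
  constructor
  · exact fun h => ⟨h.1.1, h.2⟩
  · exact fun h => ⟨⟨h.1, h.2.trans_lt this⟩, h.2⟩

theorem sum_ssubsets_apply_card [DecidableEq α] {M : Type*} [AddCommMonoid M] (G : Finset α)
    (f : ℕ → M) :
    ∑ G' ∈ G.ssubsets, f G'.card = ∑ j ∈ range G.card, G.card.choose j • f j := by
  rw [← sum_card_lt]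
  refine sum_congr ?_ fun _ _ => rfl
  ext G'
  rw [mem_ssubsets, mem_filter, mem_powerset]
  exact ⟨fun h => ⟨h.1, card_lt_card h⟩, fun h => h.1.ssubset_of_ne fun e => by
    rw [e] at h; exact h.2.false⟩

theorem IsNested.sup_eq [DecidableEq α] {G : Finset α} {τ : Multiset (Finset α)}
    (h : IsNested G τ) : τ.sup = G := by
  refine le_antisymm (Multiset.sup_le.2 h.subset_of_mem) ?_
  cases h with
  | start G =>
    rcases G.eq_empty_or_nonempty with rfl | hG
    · exact bot_le
    · exact Multiset.le_sup (Multiset.mem_replicate.2 ⟨hG.card_pos.ne', rfl⟩)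
  | step h hG ha hab =>
    exact Multiset.le_sup (Multiset.mem_add.2 (Or.inr (Multiset.mem_replicate.2 ⟨ha.ne', rfl⟩)))

theorem IsNested.count_eq_zero [DecidableEq α] {G T : Finset α} {τ : Multiset (Finset α)}
    (h : IsNested G τ) (hT : G ⊂ T) : τ.count T = 0 :=
  Multiset.count_eq_zero_of_notMem fun hm => hT.2 (h.subset_of_mem T hm)

theorem IsNested.add_replicate_inj {G₁ G₂ T : Finset α} {τ₁ τ₂ : Multiset (Finset α)} {a₁ a₂ : ℕ}
    (h₁ : IsNested G₁ τ₁) (h₂ : IsNested G₂ τ₂) (hT₁ : G₁ ⊂ T) (hT₂ : G₂ ⊂ T)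
    (h : τ₁ + Multiset.replicate a₁ T = τ₂ + Multiset.replicate a₂ T) :
    G₁ = G₂ ∧ a₁ = a₂ ∧ τ₁ = τ₂ := by
  classical
  have ha := congrArg (Multiset.count T) h
  rw [Multiset.count_add, Multiset.count_add, h₁.count_eq_zero hT₁, h₂.count_eq_zero hT₂,
    Multiset.count_replicate_self, Multiset.count_replicate_self, zero_add, zero_add] at ha
  subst ha
  have hτ := add_right_cancel h
  subst hτ
  exact ⟨h₁.sup_eq.symm.trans h₂.sup_eq, rfl, rfl⟩

variable [Fintype α]

open Polynomial

/-- The multisets which arise from a nested multiset with largest member `G ∈ P` by adding `T` with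
a multiplicity in `I G`. -/
noncomputable def appendTop [DecidableEq α] (T : Finset α) (P : Finset (Finset α))
    (I : Finset α → Finset ℕ) : Finset (Multiset (Finset α)) :=
  (P.sigma fun G => I G ×ˢ nestedFinset G).image fun q => q.2.2 + Multiset.replicate q.2.1 T

variable {T : Finset α} {P : Finset (Finset α)} {I : Finset α → Finset ℕ}

theorem mem_appendTop [DecidableEq α] {τ : Multiset (Finset α)} : τ ∈ appendTop T P I ↔
    ∃ G ∈ P, ∃ a ∈ I G, ∃ τ', IsNested G τ' ∧ τ = τ' + Multiset.replicate a T := by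
  simp only [appendTop, mem_image, mem_sigma, mem_product, mem_nestedFinset]
  constructor
  · rintro ⟨⟨G, a, τ'⟩, ⟨hG, ha, hτ'⟩, rfl⟩
    exact ⟨G, hG, a, ha, τ', hτ', rfl⟩
  · rintro ⟨G, hG, a, ha, τ', hτ', rfl⟩
    exact ⟨⟨G, a, τ'⟩, ⟨hG, ha, hτ'⟩, rfl⟩

theorem replicate_notMem_appendTop [DecidableEq α] (hP : ∀ G ∈ P, G ⊂ T) {c : ℕ}
    (hc : ∀ G ∈ P, c ∉ I G) : Multiset.replicate c T ∉ appendTop T P I := by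
  intro h
  obtain ⟨G, hG, a, ha, τ, hτ, h⟩ := mem_appendTop.1 h
  have hcount := congrArg (Multiset.count T) h
  rw [Multiset.count_add, hτ.count_eq_zero (hP G hG), Multiset.count_replicate_self,
    Multiset.count_replicate_self, zero_add] at hcount
  exact hc G hG (hcount ▸ ha)

theorem sum_appendTop [DecidableEq α] (hP : ∀ G ∈ P, G ⊂ T) (I : Finset α → Finset ℕ) :
    ∑ τ ∈ appendTop T P I, (X : ℤ[X]) ^ τ.card =
      ∑ G ∈ P, (∑ a ∈ I G, X ^ a) * ∑ τ ∈ nestedFinset G, X ^ τ.card := by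
  rw [appendTop, sum_image, sum_sigma]
  · refine sum_congr rfl fun G _ => ?_
    rw [sum_product, sum_mul_sum]
    refine sum_congr rfl fun a _ => sum_congr rfl fun τ _ => ?_
    rw [Multiset.card_add, Multiset.card_replicate, pow_add, mul_comm]
  · rintro ⟨G₁, a₁, τ₁⟩ h₁ ⟨G₂, a₂, τ₂⟩ h₂ h
    simp only [mem_coe, mem_sigma, mem_product, mem_nestedFinset] at h₁ h₂
    obtain ⟨rfl, rfl, rfl⟩ := h₁.2.2.add_replicate_inj h₂.2.2 (hP _ h₁.1) (hP _ h₂.1) h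
    rfl

theorem nestedFinset_eq_insert [DecidableEq α] (G : Finset α) :
    nestedFinset G = insert (Multiset.replicate G.card G)
      (appendTop G G.ssubsets fun G' => Ico 1 (G.card - G'.card)) := by
  ext τ
  simp only [mem_nestedFinset, mem_insert, mem_appendTop, mem_ssubsets, mem_Ico]
  constructor
  · rintro (_ | @⟨G', _, τ, a, h, hG, ha, hab⟩)
    · exact .inl rfl
    · exact .inr ⟨G', hG, a, ⟨ha, by omega⟩, τ, h, rfl⟩
  · rintro (rfl | ⟨G', hG, a, ⟨ha, hab⟩, τ, h, rfl⟩)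
    · exact .start G
    · exact h.step hG ha (by omega)

theorem sum_nestedFinset [DecidableEq α] (G : Finset α) :
    ∑ τ ∈ nestedFinset G, (X : ℤ[X]) ^ τ.card = X ^ G.card +
      ∑ G' ∈ G.ssubsets, (∑ a ∈ Ico 1 (G.card - G'.card), X ^ a) *
        ∑ τ ∈ nestedFinset G', X ^ τ.card := by
  have hP : ∀ G' ∈ G.ssubsets, G' ⊂ G := fun G' => mem_ssubsets.1
  rw [nestedFinset_eq_insert, sum_insert (replicate_notMem_appendTop hP fun G' _ => by simp),
    Multiset.card_replicate, sum_appendTop hP]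

theorem standardFinset_eq_insert [DecidableEq α] (d : ℕ) :
    standardFinset α d = insert (Multiset.replicate d univ)
      (appendTop univ {G : Finset α | G.card < d} fun G => range (d - G.card)) := by
  ext τ
  simp only [mem_standardFinset, mem_insert, mem_appendTop, mem_filter, mem_univ, true_and,
    mem_range]
  constructor
  · rintro (rfl | ⟨G, τ, a, h, ha, rfl⟩)
    · exact .inl rfl
    · exact .inr ⟨G, by omega, a, by omega, τ, h, rfl⟩
  · rintro (rfl | ⟨G, hG, a, ha, τ, h, rfl⟩)
    · exact .inl rfl
    · exact .inr ⟨G, τ, a, h, by omega, rfl⟩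

theorem sum_standardFinset {d : ℕ} (hd : d ≤ Fintype.card α) :
    ∑ τ ∈ standardFinset α d, (X : ℤ[X]) ^ τ.card = X ^ d +
      ∑ G : Finset α with G.card < d, (∑ a ∈ range (d - G.card), X ^ a) *
        ∑ τ ∈ nestedFinset G, X ^ τ.card := by
  classical
  have hP : ∀ G ∈ univ.filter (fun G : Finset α => G.card < d), G ⊂ univ := by
    intro G hG
    rw [ssubset_univ_iff]
    rintro rfl
    exact (mem_filter.1 hG).2.not_ge hd
  rw [standardFinset_eq_insert, sum_insert (replicate_notMem_appendTop hP fun G _ => by simp),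
    Multiset.card_replicate, sum_appendTop hP]

/-- The generating polynomial of nested multisets with a largest member of size `m`. -/
noncomputable def nestedPoly (m : ℕ) : ℤ[X] :=
  X ^ m + ∑ j : Fin m, (m.choose j : ℤ[X]) * ((∑ a ∈ Ico 1 (m - j), X ^ a) * nestedPoly j)

theorem nestedPoly_eq (m : ℕ) : nestedPoly m = X ^ m + ∑ j ∈ range m,
    (m.choose j : ℤ[X]) * ((∑ a ∈ Ico 1 (m - j), X ^ a) * nestedPoly j) := by
  rw [nestedPoly, sum_range]

theorem sum_nestedFinset_eq_nestedPoly (G : Finset α) :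
    ∑ τ ∈ nestedFinset G, (X : ℤ[X]) ^ τ.card = nestedPoly G.card := by
  classical
  induction G using Finset.strongInduction with
  | H G ih =>
  rw [sum_nestedFinset, nestedPoly_eq,
    sum_congr rfl fun G' hG' => by rw [ih G' (mem_ssubsets.1 hG')],
    sum_ssubsets_apply_card G fun j => (∑ a ∈ Ico 1 (G.card - j), X ^ a) * nestedPoly j]
  simp only [nsmul_eq_mul]

/-- The Hilbert series of the augmented Chow ring of the uniform matroid of rank `d` on `n`
elements. -/
noncomputable def uniformChowPoly (n d : ℕ) : ℤ[X] :=
  X ^ d + ∑ m ∈ range d, (n.choose m : ℤ[X]) * ((∑ a ∈ range (d - m), X ^ a) * nestedPoly m)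

theorem sum_standardFinset_eq {d : ℕ} (hd : d ≤ Fintype.card α) :
    ∑ τ ∈ standardFinset α d, (X : ℤ[X]) ^ τ.card = uniformChowPoly (Fintype.card α) d := by
  rw [sum_standardFinset hd, uniformChowPoly]
  simp only [sum_nestedFinset_eq_nestedPoly]
  rw [← powerset_univ, sum_card_lt _ _
    fun m => (∑ a ∈ range (d - m), X ^ a) * nestedPoly m, card_univ]
  simp only [nsmul_eq_mul]

theorem coeff_uniformChowPoly {d : ℕ} (hd : d ≤ Fintype.card α) (k : ℕ) :
    (uniformChowPoly (Fintype.card α) d).coeff k =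
      Nat.card {τ : Multiset (Finset α) // IsStandard d τ ∧ τ.card = k} := by
  rw [← sum_standardFinset_eq hd, finsetSum_coeff]
  simp only [coeff_X_pow]
  rw [← Finset.sum_filter, Finset.sum_const, nsmul_eq_mul, mul_one,
    Nat.subtype_card ((standardFinset α d).filter fun τ => k = τ.card)]
  intro τ
  rw [mem_filter, mem_standardFinset, eq_comm (a := k)]

end Counting

section Identity

open Polynomial

theorem uniformChowPoly_self (d : ℕ) :
    uniformChowPoly d d = ∑ m ∈ range (d + 1), (d.choose m : ℤ[X]) * nestedPoly m := by
  rw [sum_range_succ, nestedPoly_eq d, Nat.choose_self, Nat.cast_one, one_mul, uniformChowPoly,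
    add_left_comm, ← sum_add_distrib]
  congr 1
  refine sum_congr rfl fun m hm => ?_
  have := mem_range.1 hm
  rw [range_eq_Ico, sum_eq_sum_Ico_succ_bot (by omega)]
  simp only [pow_zero, zero_add]
  ring

theorem eval_one_nestedPoly (m : ℕ) : (nestedPoly m).eval 1 = (m.factorial : ℤ) := by
  induction m using Nat.strong_induction_on with
  | _ m ih =>
  have hterm : ∀ j ∈ range m, (m.choose j : ℤ) * ((m - j - 1 : ℕ) * j.factorial) =
      (m.descFactorial (j + 1) : ℤ) - m.descFactorial j := by
    intro j hj
    have hjm := mem_range.1 hj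
    rw [Nat.descFactorial_succ, Nat.descFactorial_eq_factorial_mul_choose, Nat.sub_sub]
    push_cast [Nat.cast_sub hjm, Nat.cast_sub hjm.le]
    ring
  rw [nestedPoly_eq, eval_add, eval_finsetSum]
  simp only [eval_mul, eval_pow, eval_X, one_pow, eval_natCast, eval_finsetSum, sum_const,
    Nat.card_Ico, nsmul_eq_mul, mul_one]
  rw [sum_congr rfl fun j hj => by rw [ih j (mem_range.1 hj), hterm j hj],
    sum_range_sub fun j => (m.descFactorial j : ℤ)]
  simp [Nat.descFactorial_self]

theorem card_standardFinset_card (α : Type*) [Fintype α] :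
    (standardFinset α (Fintype.card α)).card =
      ∑ m ∈ range (Fintype.card α + 1), (Fintype.card α).descFactorial m := by
  have hsum := congrArg (eval 1) (sum_standardFinset_eq (α := α) le_rfl)
  rw [uniformChowPoly_self, eval_finsetSum, eval_finsetSum] at hsum
  simp only [eval_pow, eval_X, one_pow, sum_const, nsmul_eq_mul, mul_one, eval_mul, eval_natCast,
    eval_one_nestedPoly] at hsum
  simp only [Nat.descFactorial_eq_factorial_mul_choose, mul_comm (Nat.factorial _)]
  exact_mod_cast hsum

theorem sum_descFactorial_le_card_nodup (α : Type*) [Fintype α] :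
    ∑ m ∈ range (Fintype.card α + 1), (Fintype.card α).descFactorial m ≤
      Fintype.card {l : List α // l.Nodup} := by
  classical
  let toList : (Σ k : Fin (Fintype.card α + 1), Fin k ↪ α) → {l : List α // l.Nodup} :=
    fun e => ⟨List.ofFn e.2, List.nodup_ofFn.2 e.2.injective⟩
  have hinj : Function.Injective toList := by
    rintro ⟨k, e⟩ ⟨l, f⟩ h
    have hkl : k = l := by simpa [toList, Fin.ext_iff] using congrArg (fun l => l.1.length) h
    subst hkl
    simpa [toList, List.ofFn_inj, DFunLike.coe_fn_eq] using h
  refine le_of_eq_of_le ?_ (Fintype.card_le_of_injective toList hinj)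
  simp only [Fintype.card_sigma, Fintype.card_embedding_eq, Fintype.card_fin,
    sum_range fun m => (Fintype.card α).descFactorial m]

theorem uniformChowPoly_zero (n : ℕ) : uniformChowPoly n 0 = 1 := by
  simp [uniformChowPoly]

theorem uniformChowPoly_succ (n d : ℕ) :
    uniformChowPoly n (d + 1) = X * uniformChowPoly n d +
      ∑ m ∈ range (d + 1), (n.choose m : ℤ[X]) * nestedPoly m := by
  rw [uniformChowPoly, uniformChowPoly, mul_add, ← pow_succ', add_assoc, sum_range_succ,
    sum_range_succ, mul_sum, ← add_assoc (∑ i ∈ range d, _), ← sum_add_distrib]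
  congr 2
  · refine sum_congr rfl fun m hm => ?_
    have := mem_range.1 hm
    rw [show d + 1 - m = d - m + 1 by omega, sum_range_succ']
    simp only [pow_succ', ← mul_sum, pow_zero]
    ring
  · simp

theorem sum_choose_sub_choose_sub {n d : ℕ} (h : d ≤ n) :
    ∑ j ∈ range (d + 1), (n - j).choose (d - j) = (n + 1).choose d := by
  induction d generalizing n with
  | zero => simp
  | succ d ih =>
    obtain ⟨n, rfl⟩ : ∃ m, n = m + 1 := ⟨n - 1, by omega⟩
    rw [sum_range_succ']
    simp only [Nat.add_sub_add_right, Nat.sub_zero]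
    rw [ih (by omega), ← Nat.choose_succ_succ]

theorem sum_Ico_choose_sub_choose_sub {n d m : ℕ} (hm : m ≤ d) (h : d < n) :
    ∑ i ∈ Ico m (d + 1), (n - i - 1).choose (d - i) = (n - m).choose (d - m) := by
  rw [sum_Ico_eq_sum_range, show d + 1 - m = d - m + 1 by omega,
    show n - m = n - m - 1 + 1 by omega,
    ← sum_choose_sub_choose_sub (by omega)]
  refine sum_congr rfl fun i _ => ?_
  rw [show n - (m + i) - 1 = n - m - 1 - i by omega, Nat.sub_add_eq]

theorem sum_choose_mul_sum_choose_mul {R : Type*} [CommSemiring R] {n d : ℕ} (h : d < n)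
    (f : ℕ → R) :
    ∑ i ∈ range (d + 1), ((n - i - 1).choose (d - i) : R) *
        ∑ m ∈ range (i + 1), (n.choose m : R) * f m =
      (n.choose d : R) * ∑ m ∈ range (d + 1), (d.choose m : R) * f m := by
  simp only [mul_sum]
  rw [sum_comm' (t' := range (d + 1)) (s' := fun m => Ico m (d + 1))
    (by intro i m; simp only [mem_range, mem_Ico]; omega)]
  refine sum_congr rfl fun m hm => ?_
  have hmd : m ≤ d := Nat.le_of_lt_succ (mem_range.1 hm)
  rw [← sum_mul, ← Nat.cast_sum, sum_Ico_choose_sub_choose_sub hmd h, ← mul_assoc, ← mul_assoc,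
    ← Nat.cast_mul, ← Nat.cast_mul, Nat.choose_mul hmd, mul_comm (n.choose m)]

/-- The right-hand side `∑ i ≤ d, C(n - i - 1, d - i) H_{U_{i,n}}` of the main identity. Truncated
subtraction gives the coefficient `1` at `i = d = n`. -/
noncomputable def chowTransform (n d : ℕ) : ℤ[X] :=
  ∑ i ∈ range (d + 1), ((n - i - 1).choose (d - i) : ℤ[X]) * uniformChowPoly n i

theorem chowTransform_self (n : ℕ) : chowTransform n n = uniformChowPoly n n := by
  rw [chowTransform, sum_range_succ, sum_eq_zero, zero_add]
  · simp
  · intro i hi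
    have := mem_range.1 hi
    rw [Nat.choose_eq_zero_of_lt (by omega), Nat.cast_zero, zero_mul]

theorem chowTransform_succ_add {n d : ℕ} (h : d < n) :
    chowTransform n (d + 1) + chowTransform n d =
      ∑ i ∈ range (d + 2), ((n - i).choose (d + 1 - i) : ℤ[X]) * uniformChowPoly n i := by
  rw [chowTransform, chowTransform, sum_range_succ, sum_range_succ _ (d + 1), add_right_comm,
    ← sum_add_distrib]
  congr 1
  · refine sum_congr rfl fun i hi => ?_
    have := mem_range.1 hi
    rw [show n - i = n - i - 1 + 1 by omega, show d + 1 - i = d - i + 1 by omega,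
      Nat.choose_succ_succ, Nat.add_sub_cancel]
    push_cast
    ring
  · simp

theorem chowTransform_succ {n d : ℕ} (h : d < n) :
    chowTransform n (d + 1) = (X - 1) * chowTransform n d + (n.choose (d + 1) : ℤ[X]) +
      (n.choose d : ℤ[X]) * uniformChowPoly d d := by
  have hsum : ∑ i ∈ range (d + 1), ((n - (i + 1)).choose (d + 1 - (i + 1)) : ℤ[X]) *
      uniformChowPoly n (i + 1) =
        X * chowTransform n d + (n.choose d : ℤ[X]) * uniformChowPoly d d := by
    rw [uniformChowPoly_self, ← sum_choose_mul_sum_choose_mul h, chowTransform, mul_sum,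
      ← sum_add_distrib]
    refine sum_congr rfl fun i _ => ?_
    rw [uniformChowPoly_succ, Nat.sub_add_eq, Nat.add_sub_add_right]
    ring
  have hadd := chowTransform_succ_add h
  rw [sum_range_succ', hsum, uniformChowPoly_zero, mul_one, Nat.sub_zero, Nat.sub_zero] at hadd
  linear_combination hadd

theorem chowTransform_eq {n d : ℕ} (h : d ≤ n) :
    chowTransform n d = ∑ s ∈ range (d + 1), (n.choose s : ℤ[X]) * (X - 1) ^ (d - s) +
      ∑ m ∈ range d, (n.choose m : ℤ[X]) * ((X - 1) ^ (d - m - 1) * uniformChowPoly m m) := by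
  induction d with
  | zero => simp [chowTransform, uniformChowPoly_zero]
  | succ d ih =>
    have hindep : ∀ s ∈ range (d + 1), (n.choose s : ℤ[X]) * (X - 1) ^ (d + 1 - s) =
        (X - 1) * ((n.choose s : ℤ[X]) * (X - 1) ^ (d - s)) := by
      intro s hs
      have := mem_range.1 hs
      rw [show d + 1 - s = d - s + 1 by omega, pow_succ]
      ring
    have hflats : ∀ m ∈ range d,
        (n.choose m : ℤ[X]) * ((X - 1) ^ (d + 1 - m - 1) * uniformChowPoly m m) =
        (X - 1) * ((n.choose m : ℤ[X]) * ((X - 1) ^ (d - m - 1) * uniformChowPoly m m)) := by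
      intro m hm
      have := mem_range.1 hm
      rw [show d + 1 - m - 1 = d - m - 1 + 1 by omega, pow_succ]
      ring
    rw [chowTransform_succ (by omega), ih (by omega), mul_add, mul_sum, mul_sum,
      sum_range_succ _ (d + 1), sum_congr rfl hindep,
      sum_range_succ (fun m => _ * (_ * uniformChowPoly m m)) d, sum_congr rfl hflats,
      Nat.sub_self, pow_zero, show d + 1 - d - 1 = 0 by omega, pow_zero]
    ring

end Identity

section Flags

open Polynomial

variable {α : Type*} [DecidableEq α] [Fintype α]

/-- The pairs `(S, c)` of a subset `S` of `T` with at most `d` elements and a chain `c` of subsets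
of `T` with less than `d` elements, all of which contain `S`. For `d ≤ |T|`, these encode the faces
of the augmented Bergman complex of the uniform matroid of rank `d` on `T`. -/
def flagFaces (T : Finset α) (d : ℕ) : Finset (Finset α × Finset (Finset α)) :=
  univ.filter fun p => p.1 ⊆ T ∧ p.1.card ≤ d ∧
    (∀ F ∈ p.2, F ⊆ T ∧ F.card < d ∧ p.1 ⊆ F) ∧ ∀ F ∈ p.2, ∀ G ∈ p.2, F ⊆ G ∨ G ⊆ F

variable {T G S : Finset α} {c : Finset (Finset α)} {d : ℕ}

theorem mem_flagFaces : (S, c) ∈ flagFaces T d ↔ S ⊆ T ∧ S.card ≤ d ∧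
    (∀ F ∈ c, F ⊆ T ∧ F.card < d ∧ S ⊆ F) ∧ ∀ F ∈ c, ∀ G ∈ c, F ⊆ G ∨ G ⊆ F := by
  simp [flagFaces]

theorem card_add_card_le_of_mem_flagFaces (h : (S, c) ∈ flagFaces T d) :
    S.card + c.card ≤ d := by
  obtain ⟨-, hS, hc, hchain⟩ := mem_flagFaces.1 h
  have hle : c.card ≤ (Ico S.card d).card := by
    refine card_le_card_of_injOn card (fun F hF => ?_) fun F hF G hG h => ?_
    · exact mem_coe.2 (mem_Ico.2 ⟨card_le_card (hc F hF).2.2, (hc F hF).2.1⟩)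
    · rcases hchain F hF G hG with hFG | hGF
      · exact eq_of_subset_of_card_le hFG h.ge
      · exact (eq_of_subset_of_card_le hGF h.le).symm
  rw [Nat.card_Ico] at hle
  omega

theorem sup_id_mem_of_mem_flagFaces (h : (S, c) ∈ flagFaces T d) (hc : c.Nonempty) :
    c.sup id ∈ c := by
  rw [sup_def, Multiset.map_id, ← mem_val]
  exact sup_mem_of_chain (by simpa using hc.ne_empty) (mem_flagFaces.1 h).2.2.2

theorem erase_sup_mem_flagFaces (h : (S, c) ∈ flagFaces T d) (hc : c.Nonempty) :
    (S, c.erase (c.sup id)) ∈ flagFaces (c.sup id) (c.sup id).card := by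
  obtain ⟨-, -, hS, hchain⟩ := mem_flagFaces.1 h
  obtain ⟨-, -, hsup⟩ := hS _ (sup_id_mem_of_mem_flagFaces h hc)
  refine mem_flagFaces.2 ⟨hsup, card_le_card hsup, fun F hF => ?_, fun F hF G hG =>
    hchain F (mem_of_mem_erase hF) G (mem_of_mem_erase hG)⟩
  have hFsup : F ⊆ c.sup id := le_sup (f := id) (mem_of_mem_erase hF)
  exact ⟨hFsup, card_lt_card (hFsup.ssubset_of_ne (ne_of_mem_erase hF)),
    (hS F (mem_of_mem_erase hF)).2.2⟩

theorem insert_mem_flagFaces (h : (S, c) ∈ flagFaces G G.card) (hGT : G ⊆ T) (hGd : G.card < d) :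
    (S, insert G c) ∈ flagFaces T d := by
  obtain ⟨hSG, hSc, hS, hchain⟩ := mem_flagFaces.1 h
  rw [mem_flagFaces]
  simp only [forall_mem_insert]
  exact ⟨hSG.trans hGT, hSc.trans hGd.le,
    ⟨⟨hGT, hGd, hSG⟩, fun F hF => ⟨(hS F hF).1.trans hGT, (hS F hF).2.1.trans hGd, (hS F hF).2.2⟩⟩,
    ⟨.inl subset_rfl, fun F hF => .inr (hS F hF).1⟩,
    fun F hF => ⟨.inl (hS F hF).1, hchain F hF⟩⟩

theorem notMem_of_mem_flagFaces (h : (S, c) ∈ flagFaces G G.card) : G ∉ c :=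
  fun hG => ((mem_flagFaces.1 h).2.2.1 G hG).2.1.false

theorem sup_insert_of_mem_flagFaces (h : (S, c) ∈ flagFaces G d) : (insert G c).sup id = G := by
  rw [sup_insert, id, sup_eq_left]
  exact Finset.sup_le fun F hF => ((mem_flagFaces.1 h).2.2.1 F hF).1

/-- The generating polynomial `∑ (X - 1) ^ (d - |S| - |c|)` of `flagFaces`. -/
noncomputable def flagPoly (T : Finset α) (d : ℕ) : ℤ[X] :=
  ∑ p ∈ flagFaces T d, (X - 1) ^ (d - (p.1.card + p.2.card))

theorem sum_flagFaces_nonempty (T : Finset α) (d : ℕ) :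
    ∑ p ∈ flagFaces T d with p.2.Nonempty, (X - 1 : ℤ[X]) ^ (d - (p.1.card + p.2.card)) =
      ∑ G ∈ T.powerset with G.card < d, (X - 1) ^ (d - G.card - 1) * flagPoly G G.card := by
  simp only [flagPoly, mul_sum]
  rw [sum_sigma']
  refine sum_bij' (fun p _ => ⟨p.2.sup id, p.1, p.2.erase (p.2.sup id)⟩)
    (fun q _ => (q.2.1, insert q.1 q.2.2)) ?_ ?_ ?_ ?_ ?_
  · rintro ⟨S, c⟩ hp
    obtain ⟨hp, hc⟩ := mem_filter.1 hp
    obtain ⟨hT, hd, -⟩ := (mem_flagFaces.1 hp).2.2.1 _ (sup_id_mem_of_mem_flagFaces hp hc)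
    exact mem_sigma.2 ⟨mem_filter.2 ⟨mem_powerset.2 hT, hd⟩, erase_sup_mem_flagFaces hp hc⟩
  · rintro ⟨G, S, c⟩ hq
    obtain ⟨hG, hq⟩ := mem_sigma.1 hq
    obtain ⟨hGT, hGd⟩ := mem_filter.1 hG
    exact mem_filter.2
      ⟨insert_mem_flagFaces hq (mem_powerset.1 hGT) hGd, insert_nonempty _ _⟩
  · rintro ⟨S, c⟩ hp
    obtain ⟨hp, hc⟩ := mem_filter.1 hp
    exact Prod.ext rfl (insert_erase (sup_id_mem_of_mem_flagFaces hp hc))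
  · rintro ⟨G, S, c⟩ hq
    have hq := (mem_sigma.1 hq).2
    dsimp only at hq ⊢
    rw [sup_insert_of_mem_flagFaces hq, erase_insert (notMem_of_mem_flagFaces hq)]
  · rintro ⟨S, c⟩ hp
    obtain ⟨hp, hc⟩ := mem_filter.1 hp
    have hle := card_add_card_le_of_mem_flagFaces (erase_sup_mem_flagFaces hp hc)
    have hmem := sup_id_mem_of_mem_flagFaces hp hc
    have hlt := ((mem_flagFaces.1 hp).2.2.1 _ hmem).2.1
    have hcard := card_erase_add_one hmem
    rw [← pow_add]
    congr 1
    dsimp only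
    omega

theorem sum_flagFaces_empty (T : Finset α) (d : ℕ) :
    ∑ p ∈ flagFaces T d with ¬ p.2.Nonempty, (X - 1 : ℤ[X]) ^ (d - (p.1.card + p.2.card)) =
      ∑ s ∈ range (d + 1), (T.card.choose s : ℤ[X]) * (X - 1) ^ (d - s) := by
  have hfilter : {p ∈ flagFaces T d | ¬ p.2.Nonempty} =
      {S ∈ T.powerset | S.card < d + 1}.map (Function.Embedding.sectL _ ∅) := by
    ext ⟨S, c⟩
    simp only [mem_filter, mem_flagFaces, not_nonempty_iff_eq_empty, mem_map, mem_powerset,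
      Function.Embedding.sectL_apply, Prod.mk.injEq]
    constructor
    · rintro ⟨⟨hST, hS, -⟩, rfl⟩
      exact ⟨S, ⟨hST, Nat.lt_succ_of_le hS⟩, rfl, rfl⟩
    · rintro ⟨S, ⟨hST, hS⟩, rfl, rfl⟩
      exact ⟨⟨hST, Nat.le_of_lt_succ hS, by simp, by simp⟩, rfl⟩
  rw [hfilter, sum_map]
  simp only [Function.Embedding.sectL_apply, card_empty, add_zero]
  rw [sum_card_lt T (d + 1) fun s => (X - 1 : ℤ[X]) ^ (d - s)]
  simp only [nsmul_eq_mul]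

theorem flagPoly_eq_chowTransform (hd : d ≤ T.card) : flagPoly T d = chowTransform T.card d := by
  induction d using Nat.strong_induction_on generalizing T with
  | _ d ih =>
  have hflats : ∀ G ∈ T.powerset.filter (fun G => G.card < d),
      (X - 1 : ℤ[X]) ^ (d - G.card - 1) * flagPoly G G.card =
        (X - 1) ^ (d - G.card - 1) * uniformChowPoly G.card G.card := by
    intro G hG
    rw [ih G.card (mem_filter.1 hG).2 le_rfl, chowTransform_self]
  rw [flagPoly, ← sum_filter_add_sum_filter_not _ (fun p => p.2.Nonempty), sum_flagFaces_empty,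
    sum_flagFaces_nonempty, chowTransform_eq hd, add_comm, sum_congr rfl hflats,
    sum_card_lt _ _ fun m => (X - 1 : ℤ[X]) ^ (d - m - 1) * uniformChowPoly m m]
  simp only [nsmul_eq_mul]

end Flags

section FlagPoints

variable {α : Type*}

theorem eq_of_find?_mem_eq [DecidableEq α] {l l' : List α} (hl : l.Nodup) (hl' : l'.Nodup)
    (h : ∀ A : Finset α, l.find? (· ∈ A) = l'.find? (· ∈ A)) : l = l' := by
  induction l generalizing l' with
  | nil =>
    cases l' with
    | nil => rfl
    | cons e l' => simpa using h {e}
  | cons e l ih =>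
    cases l' with
    | nil => simpa using h {e}
    | cons e' l' =>
      obtain rfl : e = e' := by simpa using h {e, e'}
      rw [List.nodup_cons] at hl hl'
      refine congrArg (e :: ·) (ih hl.2 hl'.2 fun A => ?_)
      have find?_erase {m : List α} (hm : e ∉ m) :
          (e :: m).find? (· ∈ A.erase e) = m.find? (· ∈ A) := by
        rw [List.find?_cons_of_neg (by simp)]
        refine List.find?_congr fun i hi => ?_
        simp [ne_of_mem_of_not_mem hi hm]
      rw [← find?_erase hl.1, h, find?_erase hl'.1]

variable [DecidableEq α] [Fintype α] {K : Type*} [Field K]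

/-- The coordinates of the point which belongs to the flag of the complements of the suffixes of
`l`. They are chosen such that the cone sum of `A` is the value of `a` at the last member of `l` in
`A`. -/
def flagCoord (a : α → K) : List α → Finset α → K
  | [], _ => 0
  | e :: l, F => if F = univ then 0 else
      flagCoord a l F + ((if F = (e :: l).toFinsetᶜ then a e else 0) -
        if F = l.toFinsetᶜ then a e else 0)

theorem flagCoord_univ (a : α → K) (l : List α) : flagCoord a l univ = 0 := by
  cases l <;> simp [flagCoord]

theorem exists_suffix_of_flagCoord_ne_zero {a : α → K} {l : List α} {F : Finset α}
    (h : flagCoord a l F ≠ 0) : ∃ s, s <:+ l ∧ F = s.toFinsetᶜ := by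
  induction l with
  | nil => exact absurd rfl h
  | cons e l ih =>
    by_cases he : F = (e :: l).toFinsetᶜ
    · exact ⟨e :: l, List.suffix_rfl, he⟩
    by_cases hl : F = l.toFinsetᶜ
    · exact ⟨l, List.suffix_cons e l, hl⟩
    obtain ⟨s, hs, hF⟩ := ih fun h0 => h (by
      rw [flagCoord, if_neg he, if_neg hl, h0, sub_zero, add_zero, ite_self])
    exact ⟨s, hs.trans (List.suffix_cons e l), hF⟩

theorem flagCoord_mul_flagCoord {F G : Finset α} (hFG : ¬ F ⊆ G) (hGF : ¬ G ⊆ F) (a : α → K)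
    (l : List α) : flagCoord a l F * flagCoord a l G = 0 := by
  by_contra h
  obtain ⟨s, hs, rfl⟩ := exists_suffix_of_flagCoord_ne_zero (left_ne_zero_of_mul h)
  obtain ⟨t, ht, rfl⟩ := exists_suffix_of_flagCoord_ne_zero (right_ne_zero_of_mul h)
  rcases List.suffix_or_suffix_of_suffix hs ht with hst | hts
  · exact hGF (compl_subset_compl.2 fun i hi =>
      List.mem_toFinset.2 (hst.subset (List.mem_toFinset.1 hi)))
  · exact hFG (compl_subset_compl.2 fun i hi =>
      List.mem_toFinset.2 (hts.subset (List.mem_toFinset.1 hi)))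

theorem coneSum_flagCoord_cons (a : α → K) (e : α) (l : List α) (A : Finset α) :
    coneSum (flagCoord a (e :: l)) A = coneSum (flagCoord a l) A +
      ((if A ⊆ (e :: l).toFinsetᶜ then 0 else a e) - if A ⊆ l.toFinsetᶜ then 0 else a e) := by
  have hcoord : ∀ F ∈ univ.filter (fun F : Finset α => ¬ A ⊆ F), flagCoord a (e :: l) F =
      flagCoord a l F + ((if F = (e :: l).toFinsetᶜ then a e else 0) -
        if F = l.toFinsetᶜ then a e else 0) := by
    intro F hF
    rw [flagCoord, if_neg]
    rintro rfl
    exact (mem_filter.1 hF).2 (subset_univ A)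
  rw [coneSum, sum_congr rfl hcoord, sum_add_distrib, sum_sub_distrib, sum_ite_eq', sum_ite_eq']
  simp only [mem_filter, mem_univ, true_and, ite_not, coneSum]

theorem coneSum_flagCoord (a : α → K) (l : List α) (A : Finset α) :
    coneSum (flagCoord a l) A = ((l.reverse.find? (· ∈ A)).map a).getD 0 := by
  induction l with
  | nil => simp [coneSum, flagCoord]
  | cons e l ih =>
    have hsub (m : List α) : A ⊆ m.toFinsetᶜ ↔ ∀ i ∈ m, i ∉ A := by
      simp only [subset_iff, mem_compl, List.mem_toFinset]
      exact ⟨fun h i hi hA => h hA hi, fun h i hA hi => h i hi hA⟩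
    rw [coneSum_flagCoord_cons, ih, List.reverse_cons, List.find?_append]
    by_cases hl : ∀ i ∈ l, i ∉ A
    · have hnone : l.reverse.find? (· ∈ A) = none := by simpa using hl
      rw [if_pos ((hsub l).2 hl), hnone]
      simp only [hsub, List.forall_mem_cons, and_iff_left hl, ite_not]
      by_cases he : e ∈ A <;> simp [he]
    · obtain ⟨i, hi⟩ : ∃ i, l.reverse.find? (· ∈ A) = some i := by
        rw [← Option.isSome_iff_exists, List.find?_isSome]
        simpa using hl
      have hel : ¬ ∀ i ∈ e :: l, i ∉ A := fun h => hl fun i hi => h i (List.mem_cons_of_mem e hi)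
      simp only [hsub, if_neg hl, if_neg hel, hi, sub_self, add_zero, Option.some_or]

theorem coneSum_flagCoord_singleton (a : α → K) {l : List α} {i : α} (hi : i ∈ l) :
    coneSum (flagCoord a l) {i} = a i := by
  have hfind : l.reverse.find? (· ∈ ({i} : Finset α)) = some i := by
    obtain ⟨j, hj⟩ : ∃ j, l.reverse.find? (· ∈ ({i} : Finset α)) = some j := by
      rw [← Option.isSome_iff_exists, List.find?_isSome]
      exact ⟨i, List.mem_reverse.2 hi, by simp⟩
    have hji : j = i := by simpa using List.find?_some hj
    rw [hj, hji]
  rw [coneSum_flagCoord, hfind, Option.map_some, Option.getD_some]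

theorem flagCoord_injOn {a : α → K} (ha : Function.Injective a) (ha0 : ∀ i, a i ≠ 0) :
    Set.InjOn (flagCoord a) {l | l.Nodup} := by
  intro l hl l' hl' h
  rw [← List.reverse_inj]
  refine eq_of_find?_mem_eq (List.nodup_reverse.2 hl) (List.nodup_reverse.2 hl') fun A => ?_
  have hA := congrArg (coneSum · A) h
  simp only [coneSum_flagCoord] at hA
  cases hf : l.reverse.find? (· ∈ A) <;> cases hf' : l'.reverse.find? (· ∈ A) <;>
    simp_all [ha.eq_iff, eq_comm]

end FlagPoints

section BooleanCase

open MvPolynomial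

variable {α : Type*} [Fintype α] [DecidableEq α] {K : Type*} [Field K]

/-- The evaluation of polynomials at the points of all flags. -/
noncomputable def flagEval (a : α → K) :
    MvPolynomial (Finset α) K →ₐ[K] {l : List α // l.Nodup} → K :=
  aeval fun F l => flagCoord a l F

/-- The ideal of the leading forms of the polynomials which vanish at the points of all flags. -/
noncomputable def flagIdeal (a : α → K) : Ideal (MvPolynomial (Finset α) K) :=
  leadingIdeal (homogeneousSubmodule (Finset α) K) (flagEval a)

/-- The quotient of the polynomial ring by the leading forms of the equations of the points of all
flags. It has the monomial basis which is expected of the augmented Chow ring of the Boolean matroid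
on `α`. -/
abbrev FlagRing (a : α → K) : Type _ := MvPolynomial (Finset α) K ⧸ flagIdeal a

/-- The class of the variable which belongs to `F`. -/
noncomputable def flagVar (a : α → K) (F : Finset α) : FlagRing a :=
  Ideal.Quotient.mk (flagIdeal a) (X F)

theorem flagEval_X (a : α → K) (F : Finset α) (l : {l : List α // l.Nodup}) :
    flagEval a (X F) l = flagCoord a l F :=
  congrFun (aeval_X _ F) l

theorem mem_flagIdeal_of_flagEval_eq_zero {a : α → K} {k : ℕ} {p : MvPolynomial (Finset α) K}
    (hp : p.IsHomogeneous k) (h : flagEval a p = 0) : p ∈ flagIdeal a :=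
  mem_leadingIdeal (𝒜 := homogeneousSubmodule (Finset α) K) hp (h ▸ zero_mem _)

theorem X_univ_mem_flagIdeal (a : α → K) : X univ ∈ flagIdeal a :=
  mem_flagIdeal_of_flagEval_eq_zero (isHomogeneous_X K univ) <| funext fun l => by
    rw [flagEval_X, flagCoord_univ, Pi.zero_apply]

theorem X_mul_X_mem_flagIdeal (a : α → K) {F G : Finset α} (hFG : ¬ F ⊆ G) (hGF : ¬ G ⊆ F) :
    X F * X G ∈ flagIdeal a :=
  mem_flagIdeal_of_flagEval_eq_zero ((isHomogeneous_X K F).mul (isHomogeneous_X K G)) <|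
    funext fun l => by
      rw [map_mul, Pi.mul_apply, flagEval_X, flagEval_X, flagCoord_mul_flagCoord hFG hGF,
        Pi.zero_apply]

theorem flagEval_coneSum_singleton_mul_X (a : α → K) {i : α} {F : Finset α} (hi : i ∉ F) :
    flagEval a (coneSum X {i} * X F) = flagEval a (C (a i) * X F) := by
  funext l
  have hcone : flagEval a (coneSum X {i}) l = coneSum (flagCoord a l) {i} := by
    simp only [coneSum, map_sum, Finset.sum_apply, flagEval_X]
  have hC : flagEval a (C (a i)) l = a i := by
    rw [algHom_C, Pi.algebraMap_apply, Algebra.algebraMap_self, RingHom.id_apply]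
  rw [map_mul, map_mul, Pi.mul_apply, Pi.mul_apply, flagEval_X, hcone, hC]
  by_cases h : flagCoord a l F = 0
  · rw [h, mul_zero, mul_zero]
  · obtain ⟨s, hs, rfl⟩ := exists_suffix_of_flagCoord_ne_zero h
    rw [mem_compl, not_not, List.mem_toFinset] at hi
    rw [coneSum_flagCoord_singleton a (hs.subset hi)]

theorem coneSum_singleton_mul_X_mem_flagIdeal (a : α → K) {i : α} {F : Finset α} (hi : i ∉ F) :
    coneSum X {i} * X F ∈ flagIdeal a := by
  refine mem_leadingIdeal (𝒜 := homogeneousSubmodule (Finset α) K)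
    ((isHomogeneous_coneSum (isHomogeneous_X K) {i}).mul (isHomogeneous_X K F)) ?_
  rw [flagEval_coneSum_singleton_mul_X a hi]
  exact apply_mem_lowDegreeImage one_lt_two (isHomogeneous_C_mul_X (a i) F)

theorem augChowRelations_flagVar (a : α → K) :
    AugChowRelations (Fintype.card α) (flagVar a) (fun i => coneSum (flagVar a) {i}) where
  eq_zero_of_le_card F hF := by
    rw [← card_univ] at hF
    rw [eq_of_subset_of_card_le (subset_univ F) hF]
    exact Ideal.Quotient.eq_zero_iff_mem.2 (X_univ_mem_flagIdeal a)
  eq_sum i := by simp only [coneSum, singleton_subset_iff]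
  mul_eq_zero_of_not_subset F G hFG hGF :=
    Ideal.Quotient.eq_zero_iff_mem.2 (X_mul_X_mem_flagIdeal a hFG hGF)
  mul_eq_zero_of_notMem i F hi := by
    have h := Ideal.Quotient.eq_zero_iff_mem.2 (coneSum_singleton_mul_X_mem_flagIdeal a hi)
    rwa [map_mul, map_coneSum] at h

theorem coneMonomial_flagVar (a : α → K) (τ : Multiset (Finset α)) :
    coneMonomial (flagVar a) τ = Ideal.Quotient.mk (flagIdeal a) (coneMonomial X τ) :=
  (map_coneMonomial X (Ideal.Quotient.mk (flagIdeal a)) τ).symm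

theorem exists_mem_span_coneMonomial_sub_mem_flagIdeal (a : α → K) {k : ℕ}
    {p : MvPolynomial (Finset α) K} (hp : p.IsHomogeneous k) :
    ∃ q ∈ Submodule.span K (coneMonomial X '' {τ | IsStandard (Fintype.card α) τ ∧ τ.card = k}),
      p - q ∈ flagIdeal a := by
  have r := augChowRelations_flagVar a
  have hmem := r.aeval_mem_span_isStandard
    (mem_span_range_coneSum (R := K) (r.univ_eq_zero le_rfl)) hp
  have haeval : aeval (flagVar a) p = Ideal.Quotient.mkₐ K (flagIdeal a) p :=
    DFunLike.congr_fun (algHom_ext (f := aeval (flagVar a)) fun F => aeval_X _ F) p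
  have hmonomial : coneMonomial (flagVar a) =
      (Ideal.Quotient.mkₐ K (flagIdeal a)).toLinearMap ∘ coneMonomial X :=
    funext (coneMonomial_flagVar a)
  rw [haeval, hmonomial, Set.image_comp, ← Submodule.map_span] at hmem
  obtain ⟨q, hq, hqp⟩ := hmem
  exact ⟨q, hq, Ideal.Quotient.eq.1 hqp.symm⟩

theorem linearIndependent_coneMonomial_flagVar {a : α → K} (ha : Function.Injective a)
    (ha0 : ∀ i, a i ≠ 0) (k : ℕ) :
    LinearIndependent K
      fun τ : {τ : Multiset (Finset α) // IsStandard (Fintype.card α) τ ∧ τ.card = k} =>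
        coneMonomial (flagVar a) τ.1 := by
  have hsurj : Function.Surjective (flagEval a) :=
    aeval_surjective_of_injective fun l l' h => Subtype.ext (flagCoord_injOn ha ha0 l.2 l'.2 h)
  have hcard : Fintype.card {τ // τ ∈ standardFinset α (Fintype.card α)} ≤
      Module.finrank K ({l : List α // l.Nodup} → K) := by
    rw [Fintype.card_coe, Module.finrank_fintype_fun_eq_card, card_standardFinset_card]
    exact sum_descFactorial_le_card_nodup α
  let _ := gradedAlgebra (σ := Finset α) (R := K)
  have hindep := linearIndependent_mk_leadingIdeal
    (𝒜 := homogeneousSubmodule (Finset α) K) (deg := fun τ => τ.1.card) hsurj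
    (fun τ : {τ // τ ∈ standardFinset α (Fintype.card α)} =>
      isHomogeneous_coneMonomial (isHomogeneous_X K) τ.1)
    (fun k p hp => ?_) hcard k
  · let e (τ : {τ : Multiset (Finset α) // IsStandard (Fintype.card α) τ ∧ τ.card = k}) :
        {τ : {τ // τ ∈ standardFinset α (Fintype.card α)} // τ.1.card = k} :=
      ⟨⟨τ.1, mem_standardFinset.2 τ.2.1⟩, τ.2.2⟩
    have he : Function.Injective e := fun τ τ' h => Subtype.ext (congrArg (·.1.1) h)
    simp only [coneMonomial_flagVar]
    exact hindep.comp e he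
  · obtain ⟨q, hq, hpq⟩ := exists_mem_span_coneMonomial_sub_mem_flagIdeal a hp
    refine ⟨q, Submodule.span_mono ?_ hq, hpq⟩
    rintro _ ⟨τ, ⟨hτ, rfl⟩, rfl⟩
    exact ⟨⟨τ, mem_standardFinset.2 hτ⟩, rfl, rfl⟩

end BooleanCase

section Truncation

theorem linearIndependent_mk_torsionOf {ι K C M : Type*} [CommRing K] [CommRing C] [Algebra K C]
    [AddCommGroup M] [Module K M] [Module C M] [IsScalarTower K C M] {v : ι → C} {m : M}
    (h : LinearIndependent K fun i => v i • m) :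
    LinearIndependent K fun i => Ideal.Quotient.mk (Ideal.torsionOf C M m) (v i) :=
  LinearIndependent.of_comp (((Ideal.torsionOf C M m).liftQ (LinearMap.toSpanSingleton C M m)
    le_rfl).restrictScalars K) h

variable {α : Type*} [Fintype α] [DecidableEq α] {C : Type*} [CommRing C] {x : Finset α → C}
  {y : α → C}

namespace AugChowRelations

theorem mul_coneSum_univ_pow (r : AugChowRelations (Fintype.card α) x y) {m : ℕ} {F : Finset α}
    (hF : Fintype.card α ≤ F.card + m) : x F * coneSum x univ ^ m = 0 := by
  induction m generalizing F with
  | zero => rw [r.eq_zero_of_le_card F hF, zero_mul]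
  | succ m ih =>
    rcases eq_or_ne F univ with rfl | hne
    · rw [r.univ_eq_zero le_rfl, zero_mul]
    obtain ⟨i, -, hi⟩ := exists_of_ssubset (ssubset_univ_iff.2 hne)
    have hmul : x F * coneSum x univ =
        ∑ G with insert i F ⊆ G ∧ ¬ univ ⊆ G, x F * x G := by
      rw [← mul_sum, ← coneSum_sub x (subset_univ _), mul_sub,
        r.mul_coneSum_insert subset_rfl hi, sub_zero]
    rw [pow_succ', ← mul_assoc, hmul, sum_mul]
    refine sum_eq_zero fun G hG => ?_
    have hcard := card_le_card (mem_filter.1 hG).2.1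
    rw [card_insert_of_notMem hi] at hcard
    rw [mul_assoc, ih (by omega), mul_zero]

theorem truncate (r : AugChowRelations (Fintype.card α) x y) {d m : ℕ}
    (h : Fintype.card α = d + m) :
    AugChowRelations d
      (fun F => Ideal.Quotient.mk (Ideal.torsionOf C C (coneSum x univ ^ m)) (x F))
      (fun i => Ideal.Quotient.mk (Ideal.torsionOf C C (coneSum x univ ^ m)) (y i)) where
  eq_zero_of_le_card F hF := by
    rw [Ideal.Quotient.eq_zero_iff_mem, Ideal.mem_torsionOf_iff, smul_eq_mul]
    exact r.mul_coneSum_univ_pow (by omega)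
  eq_sum i := by rw [r.eq_sum, map_sum]
  mul_eq_zero_of_not_subset F G hFG hGF := by
    rw [← map_mul, r.mul_eq_zero_of_not_subset F G hFG hGF, map_zero]
  mul_eq_zero_of_notMem i F hi := by
    rw [← map_mul, r.mul_eq_zero_of_notMem i F hi, map_zero]

end AugChowRelations

theorem linearIndependent_coneMonomial_mk_torsionOf {K : Type*} [CommRing K] [Algebra K C]
    {d m : ℕ}
    (h : ∀ k, LinearIndependent K fun τ : {τ // IsStandard (d + m) τ ∧ τ.card = k} =>
      coneMonomial x τ.1) (k : ℕ) :
    LinearIndependent K fun τ : {τ // IsStandard d τ ∧ τ.card = k} => coneMonomial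
      (fun F => Ideal.Quotient.mk (Ideal.torsionOf C C (coneSum x univ ^ m)) (x F)) τ.1 := by
  let e (τ : {τ : Multiset (Finset α) // IsStandard d τ ∧ τ.card = k}) :
      {τ : Multiset (Finset α) // IsStandard (d + m) τ ∧ τ.card = k + m} :=
    ⟨τ.1 + Multiset.replicate m univ, τ.2.1.add_replicate_univ m, by
      rw [Multiset.card_add, τ.2.2, Multiset.card_replicate]⟩
  have he : Function.Injective e := fun τ τ' h =>
    Subtype.ext (add_right_cancel (congrArg Subtype.val h))
  simp only [← map_coneMonomial]
  refine linearIndependent_mk_torsionOf ?_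
  simpa only [Function.comp_def, e, coneMonomial_add, coneMonomial_replicate, smul_eq_mul] using
    (h (k + m)).comp e he

end Truncation

section UniformMatroid

open Matroid

variable {d n : ℕ}

theorem uniformMatroid_ground (d n : ℕ) : (uniformMatroid d n).E = Set.univ := rfl

theorem uniformMatroid_indep_iff {I : Set (Fin n)} :
    (uniformMatroid d n).Indep I ↔ I.ncard ≤ d := by
  simp [uniformMatroid]

theorem uniformMatroid_isFlat_of_ncard_lt {F : Set (Fin n)} (h : F.ncard < d) :
    (uniformMatroid d n).IsFlat F := by
  refine ⟨fun I X hIF hIX => ?_, Set.subset_univ _⟩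
  obtain rfl : I = F :=
    hIF.eq_of_subset_indep (uniformMatroid_indep_iff.2 h.le) hIF.subset subset_rfl
  intro i hi
  by_contra hiI
  have hindep : (uniformMatroid d n).Indep (insert i I) := by
    rw [uniformMatroid_indep_iff, Set.ncard_insert_of_notMem hiI]
    exact h
  have heq := hIX.eq_of_subset_indep hindep (Set.subset_insert i I)
    (Set.insert_subset hi hIX.subset)
  exact hiI (heq ▸ Set.mem_insert i I)

theorem uniformMatroid_isFlat_and_ne_iff (hd : d ≤ n) {F : Set (Fin n)} :
    ((uniformMatroid d n).IsFlat F ∧ F ≠ (uniformMatroid d n).E) ↔ F.ncard < d := by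
  rw [uniformMatroid_ground]
  refine ⟨fun ⟨hF, hne⟩ => not_le.1 fun hle => hne ?_,
    fun h => ⟨uniformMatroid_isFlat_of_ncard_lt h, ?_⟩⟩
  · obtain ⟨I, hIF, hI⟩ := Set.exists_subset_card_eq hle
    have isBasis_of_subset {X : Set (Fin n)} (hIX : I ⊆ X) : (uniformMatroid d n).IsBasis I X := by
      rw [isBasis_iff (Set.subset_univ _)]
      refine ⟨uniformMatroid_indep_iff.2 hI.le, hIX, fun J hJ hIJ _ => ?_⟩
      exact Set.eq_of_subset_of_ncard_le hIJ ((uniformMatroid_indep_iff.1 hJ).trans_eq hI.symm)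
    exact Set.eq_univ_of_univ_subset (hF.subset_of_isBasis_of_isBasis
      (isBasis_of_subset hIF) (isBasis_of_subset (Set.subset_univ I)))
  · rintro rfl
    rw [Set.ncard_univ, Nat.card_fin] at h
    omega

/-- The proper flat given by a set with less than `d` elements. -/
def flatOfFinset (hd : d ≤ n) (F : Finset (Fin n)) (hF : F.card < d) :
    (uniformMatroid d n).ProperFlat :=
  ⟨F, (uniformMatroid_isFlat_and_ne_iff hd).2 (by rwa [Set.ncard_coe_finset])⟩

/-- The finite set underlying a proper flat. -/
noncomputable def finsetOfFlat (F : (uniformMatroid d n).ProperFlat) : Finset (Fin n) :=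
  (Set.toFinite F.1).toFinset

theorem coe_finsetOfFlat (F : (uniformMatroid d n).ProperFlat) :
    (finsetOfFlat F : Set (Fin n)) = F.1 := Set.Finite.coe_toFinset _

theorem mem_finsetOfFlat {i : Fin n} {F : (uniformMatroid d n).ProperFlat} :
    i ∈ finsetOfFlat F ↔ i ∈ F.1 := Set.Finite.mem_toFinset _

theorem finsetOfFlat_subset_iff {F G : (uniformMatroid d n).ProperFlat} :
    finsetOfFlat F ⊆ finsetOfFlat G ↔ F.1 ⊆ G.1 := by
  rw [← coe_subset, coe_finsetOfFlat, coe_finsetOfFlat]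

theorem card_finsetOfFlat (hd : d ≤ n) (F : (uniformMatroid d n).ProperFlat) :
    (finsetOfFlat F).card < d := by
  rw [← Set.ncard_coe_finset, coe_finsetOfFlat]
  exact (uniformMatroid_isFlat_and_ne_iff hd).1 F.2

theorem flatOfFinset_finsetOfFlat (hd : d ≤ n) (F : (uniformMatroid d n).ProperFlat) :
    flatOfFinset hd (finsetOfFlat F) (card_finsetOfFlat hd F) = F :=
  Subtype.ext (coe_finsetOfFlat F)

theorem finsetOfFlat_flatOfFinset (hd : d ≤ n) (F : Finset (Fin n)) (hF : F.card < d) :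
    finsetOfFlat (flatOfFinset hd F hF) = F :=
  coe_injective (coe_finsetOfFlat _)

theorem finsetOfFlat_injective :
    Function.Injective (finsetOfFlat : (uniformMatroid d n).ProperFlat → Finset (Fin n)) :=
  fun F G h => Subtype.ext (by rw [← coe_finsetOfFlat, h, coe_finsetOfFlat])

theorem sum_flats_eq_sum_finsets (hd : d ≤ n) {A : Type*} [AddCommMonoid A]
    (f : (uniformMatroid d n).ProperFlat → A) (i : Fin n) :
    ∑ F ∈ (Set.toFinite {F : (uniformMatroid d n).ProperFlat | i ∉ F.1}).toFinset, f F =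
      ∑ F with i ∉ F, if hF : F.card < d then f (flatOfFinset hd F hF) else 0 := by
  refine sum_of_injOn finsetOfFlat finsetOfFlat_injective.injOn
    (fun F hF => ?maps) (fun F hF hF' => ?outside) fun F _ => ?eq
  case maps =>
    rw [mem_coe, Set.Finite.mem_toFinset] at hF
    exact mem_coe.2 (mem_filter.2 ⟨mem_univ _, fun h => hF (mem_finsetOfFlat.1 h)⟩)
  case outside =>
    refine dif_neg fun hc => hF' ⟨flatOfFinset hd F hc, ?_, finsetOfFlat_flatOfFinset hd F hc⟩
    rw [mem_coe, Set.Finite.mem_toFinset]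
    exact fun h => (mem_filter.1 hF).2 (mem_coe.1 h)
  case eq => rw [dif_pos (card_finsetOfFlat hd F), flatOfFinset_finsetOfFlat]

end UniformMatroid

section UniformChowRing

open Matroid

variable {d n : ℕ}

/-- The variable of a set with less than `d` elements, and zero for larger sets. -/
noncomputable def flatVar (hd : d ≤ n) (F : Finset (Fin n)) :
    MvPolynomial (uniformMatroid d n).AugVertex ℚ :=
  if hF : F.card < d then MvPolynomial.X (Sum.inr (flatOfFinset hd F hF)) else 0

/-- The variable of an element of the ground set. -/
noncomputable def elementVar (d : ℕ) (i : Fin n) :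
    MvPolynomial (uniformMatroid d n).AugVertex ℚ :=
  MvPolynomial.X (Sum.inl ⟨i, Set.mem_univ i⟩)

/-- The class of `flatVar` in the augmented Chow ring. -/
noncomputable def flatClass (hd : d ≤ n) (F : Finset (Fin n)) :
    (uniformMatroid d n).AugmentedChowRing :=
  Ideal.Quotient.mk _ (flatVar hd F)

/-- The class of `elementVar` in the augmented Chow ring. -/
noncomputable def elementClass (d : ℕ) (i : Fin n) : (uniformMatroid d n).AugmentedChowRing :=
  Ideal.Quotient.mk _ (elementVar d i)

theorem flatVar_finsetOfFlat (hd : d ≤ n) (F : (uniformMatroid d n).ProperFlat) :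
    flatVar hd (finsetOfFlat F) = MvPolynomial.X (Sum.inr F) := by
  rw [flatVar, dif_pos (card_finsetOfFlat hd F), flatOfFinset_finsetOfFlat]

theorem sum_X_flat_eq_sum_flatVar (hd : d ≤ n) (i : Fin n) :
    ∑ F ∈ (Set.toFinite {F : (uniformMatroid d n).ProperFlat | i ∉ F.1}).toFinset,
      MvPolynomial.X (Sum.inr F) = ∑ F with i ∉ F, flatVar hd F :=
  sum_flats_eq_sum_finsets hd _ i

theorem augChowRelations_flatClass (hd : d ≤ n) :
    AugChowRelations d (flatClass hd) (elementClass d) where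
  eq_zero_of_le_card F hF := by rw [flatClass, flatVar, dif_neg hF.not_gt, map_zero]
  eq_sum i := by
    simp only [flatClass]
    rw [← map_sum, elementClass, Ideal.Quotient.eq, ← sum_X_flat_eq_sum_flatVar]
    exact Ideal.subset_span (.inl (.inl ⟨⟨i, Set.mem_univ i⟩, rfl⟩))
  mul_eq_zero_of_not_subset F G hFG hGF := by
    rw [flatClass, flatClass, ← map_mul, Ideal.Quotient.eq_zero_iff_mem, flatVar, flatVar]
    split_ifs with hF hG
    · exact Ideal.subset_span (.inl (.inr ⟨flatOfFinset hd F hF, flatOfFinset hd G hG,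
        fun h => hFG (coe_subset.1 h), fun h => hGF (coe_subset.1 h), rfl⟩))
    all_goals simp only [mul_zero, zero_mul, zero_mem]
  mul_eq_zero_of_notMem i F hi := by
    rw [elementClass, flatClass, ← map_mul, Ideal.Quotient.eq_zero_iff_mem, flatVar]
    split_ifs with hF
    · exact Ideal.subset_span (.inr ⟨⟨i, Set.mem_univ i⟩, flatOfFinset hd F hF,
        fun h => hi (mem_coe.1 h), rfl⟩)
    · rw [mul_zero]
      exact zero_mem _

theorem AugChowRelations.exists_algHom_flatClass {C : Type*} [CommRing C] [Algebra ℚ C]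
    {x : Finset (Fin n) → C} {y : Fin n → C} (r : AugChowRelations d x y) (hd : d ≤ n) :
    ∃ f : (uniformMatroid d n).AugmentedChowRing →ₐ[ℚ] C, ∀ F, f (flatClass hd F) = x F := by
  let φ : MvPolynomial (uniformMatroid d n).AugVertex ℚ →ₐ[ℚ] C :=
    MvPolynomial.aeval (Sum.elim (fun i => y i) fun F => x (finsetOfFlat F))
  have hinl (i) : φ (MvPolynomial.X (Sum.inl i)) = y i := MvPolynomial.aeval_X _ _
  have hinr (F) : φ (MvPolynomial.X (Sum.inr F)) = x (finsetOfFlat F) := MvPolynomial.aeval_X _ _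
  have hflat (F) : φ (flatVar hd F) = x F := by
    rw [flatVar]
    split_ifs with hF
    · rw [hinr, finsetOfFlat_flatOfFinset]
    · rw [map_zero, r.eq_zero_of_le_card F (not_lt.1 hF)]
  have hker : (uniformMatroid d n).augmentedChowIdeal ≤ RingHom.ker φ := by
    refine Ideal.span_le.2 ?_
    rintro p ((⟨i, rfl⟩ | ⟨F, G, hFG, hGF, rfl⟩) | ⟨i, F, hi, rfl⟩)
    · rw [SetLike.mem_coe, RingHom.mem_ker, map_sub, hinl, sum_X_flat_eq_sum_flatVar hd, map_sum,
        r.eq_sum, sub_eq_zero]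
      exact sum_congr rfl fun F _ => (hflat F).symm
    · rw [SetLike.mem_coe, RingHom.mem_ker, map_mul, hinr, hinr]
      exact r.mul_eq_zero_of_not_subset _ _ (hFG <| finsetOfFlat_subset_iff.1 ·)
        (hGF <| finsetOfFlat_subset_iff.1 ·)
    · rw [SetLike.mem_coe, RingHom.mem_ker, map_mul, hinl, hinr]
      exact r.mul_eq_zero_of_notMem _ _ (hi <| mem_finsetOfFlat.1 ·)
  exact ⟨Ideal.Quotient.liftₐ _ φ hker, hflat⟩

theorem linearIndependent_coneMonomial_flatClass (hd : d ≤ n) (k : ℕ) :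
    LinearIndependent ℚ
      fun τ : {τ : Multiset (Finset (Fin n)) // IsStandard d τ ∧ τ.card = k} =>
        coneMonomial (flatClass hd) τ.1 := by
  let a (i : Fin n) : ℚ := i + 1
  have ha : Function.Injective a := fun i j h =>
    Fin.ext (Nat.cast_injective (add_right_cancel h))
  have ha0 (i) : a i ≠ 0 := Nat.cast_add_one_ne_zero i.1
  have hcard : Fintype.card (Fin n) = d + (n - d) := by rw [Fintype.card_fin]; omega
  obtain ⟨f, hf⟩ := ((augChowRelations_flagVar a).truncate hcard).exists_algHom_flatClass hd
  refine LinearIndependent.of_comp f.toLinearMap ?_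
  simp only [Function.comp_def, AlgHom.toLinearMap_apply, map_coneMonomial, hf]
  exact linearIndependent_coneMonomial_mk_torsionOf
    (hcard ▸ linearIndependent_coneMonomial_flagVar ha ha0) k

theorem isHomogeneous_flatVar (hd : d ≤ n) (F : Finset (Fin n)) :
    (flatVar hd F).IsHomogeneous 1 := by
  rw [flatVar]
  split_ifs
  · exact MvPolynomial.isHomogeneous_X _ _
  · exact MvPolynomial.isHomogeneous_zero _ _ _

theorem coneMonomial_mem_augmentedChowPiece (hd : d ≤ n) (τ : Multiset (Finset (Fin n))) :
    coneMonomial (flatClass hd) τ ∈ (uniformMatroid d n).augmentedChowPiece τ.card :=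
  Submodule.mem_map.2 ⟨coneMonomial (flatVar hd) τ,
    isHomogeneous_coneMonomial (isHomogeneous_flatVar hd) τ,
    map_coneMonomial _ (Ideal.Quotient.mk _) τ⟩

theorem mk_X_mem_span_range_coneSum (hd : d ≤ n) (v : (uniformMatroid d n).AugVertex) :
    Ideal.Quotient.mkₐ ℚ (uniformMatroid d n).augmentedChowIdeal (MvPolynomial.X v) ∈
      Submodule.span ℚ (Set.range (coneSum (flatClass hd))) := by
  have r := augChowRelations_flatClass hd
  rcases v with i | F
  · exact Submodule.subset_span ⟨{i.1}, r.coneSum_singleton i.1⟩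
  · rw [← flatVar_finsetOfFlat hd]
    exact mem_span_range_coneSum (r.univ_eq_zero (by rwa [Fintype.card_fin])) (finsetOfFlat F)

theorem augmentedChowPiece_eq_span (hd : d ≤ n) (k : ℕ) :
    (uniformMatroid d n).augmentedChowPiece k = Submodule.span ℚ
      (coneMonomial (flatClass hd) '' {τ | IsStandard d τ ∧ τ.card = k}) := by
  refine le_antisymm (Submodule.map_le_iff_le_comap.2 fun p hp => ?_) (Submodule.span_le.2 ?_)
  · have hmk : Ideal.Quotient.mkₐ ℚ (uniformMatroid d n).augmentedChowIdeal p =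
        MvPolynomial.aeval (fun v => Ideal.Quotient.mkₐ ℚ _ (MvPolynomial.X v)) p :=
      DFunLike.congr_fun (MvPolynomial.aeval_unique _) p
    rw [Submodule.mem_comap, AlgHom.toLinearMap_apply, hmk]
    exact (augChowRelations_flatClass hd).aeval_mem_span_isStandard
      (mk_X_mem_span_range_coneSum hd) hp
  · rintro _ ⟨τ, ⟨-, rfl⟩, rfl⟩
    exact coneMonomial_mem_augmentedChowPiece hd τ

theorem finrank_augmentedChowPiece (hd : d ≤ n) (k : ℕ) :
    Module.finrank ℚ ((uniformMatroid d n).augmentedChowPiece k) =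
      Nat.card {τ : Multiset (Finset (Fin n)) // IsStandard d τ ∧ τ.card = k} := by
  have : Finite {τ : Multiset (Finset (Fin n)) // IsStandard d τ ∧ τ.card = k} :=
    ((finite_isStandard d).subset fun _ h => h.1).to_subtype
  have := Fintype.ofFinite {τ : Multiset (Finset (Fin n)) // IsStandard d τ ∧ τ.card = k}
  rw [augmentedChowPiece_eq_span hd, Set.image_eq_range]
  exact (finrank_span_eq_card (linearIndependent_coneMonomial_flatClass hd k)).trans
    Nat.card_eq_fintype_card.symm

theorem augmentedChowSeries_uniformMatroid (hd : d ≤ n) :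
    (uniformMatroid d n).augmentedChowSeries = (uniformChowPoly n d : PowerSeries ℤ) := by
  ext k
  have hcoeff := coeff_uniformChowPoly (α := Fin n) (d := d) (by rwa [Fintype.card_fin]) k
  rw [Fintype.card_fin] at hcoeff
  rw [augmentedChowSeries, PowerSeries.coeff_mk, Polynomial.coeff_coe,
    finrank_augmentedChowPiece hd, hcoeff]

end UniformChowRing

section Bergman

open Matroid

variable {d n : ℕ}

/-- The pair of a set and a family of sets given by a set of vertices of the augmented Bergman
complex. -/
noncomputable def flagOfFace (σ : Finset (uniformMatroid d n).AugVertex) :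
    Finset (Fin n) × Finset (Finset (Fin n)) :=
  (σ.toLeft.image fun i => i.1, σ.toRight.image finsetOfFlat)

theorem card_flagOfFace (σ : Finset (uniformMatroid d n).AugVertex) :
    (flagOfFace σ).1.card + (flagOfFace σ).2.card = σ.card := by
  rw [flagOfFace, card_image_of_injective _ Subtype.val_injective,
    card_image_of_injective _ finsetOfFlat_injective, card_toLeft_add_card_toRight]

theorem flagOfFace_injective :
    Function.Injective (flagOfFace : Finset (uniformMatroid d n).AugVertex → _) := by
  intro σ τ h
  obtain ⟨hleft, hright⟩ := Prod.mk.injEq .. ▸ h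
  rw [← toLeft_disjSum_toRight (u := σ), image_injective Subtype.val_injective hleft,
    image_injective finsetOfFlat_injective hright, toLeft_disjSum_toRight]

theorem mem_faces_iff_flagOfFace_mem (hd : d ≤ n) {σ : Finset (uniformMatroid d n).AugVertex} :
    σ ∈ (uniformMatroid d n).augmentedBergmanComplex.faces ↔ flagOfFace σ ∈ flagFaces univ d := by
  have hset : {a : Fin n | ∃ i : (uniformMatroid d n).E, (i : Fin n) = a ∧ Sum.inl i ∈ σ} =
      (σ.toLeft.image fun i => i.1 : Finset (Fin n)) := by
    ext a
    simp only [Set.mem_ofPred_eq, coe_image, Set.mem_image, mem_coe, mem_toLeft, and_comm]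
  rw [augmentedBergmanComplex, Set.Finite.mem_toFinset, Set.mem_ofPred_eq, IsAugFace, hset,
    uniformMatroid_indep_iff, Set.ncard_coe_finset, flagOfFace, mem_flagFaces]
  simp only [forall_mem_image, mem_toRight, finsetOfFlat_subset_iff, subset_univ, true_and,
    card_finsetOfFlat hd, image_subset_iff, mem_toLeft, mem_finsetOfFlat]
  grind

theorem exists_flagOfFace_eq (hd : d ≤ n) {S : Finset (Fin n)} {c : Finset (Finset (Fin n))}
    (hc : ∀ F ∈ c, F.card < d) :
    ∃ σ : Finset (uniformMatroid d n).AugVertex, flagOfFace σ = (S, c) := by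
  classical
  refine ⟨(S.image fun i => (⟨i, Set.mem_univ i⟩ : (uniformMatroid d n).E)).disjSum
    (c.attach.image fun F => flatOfFinset hd F.1 (hc F.1 F.2)), ?_⟩
  rw [flagOfFace, toLeft_disjSum, toRight_disjSum, image_image, image_image]
  simp only [Function.comp_def, finsetOfFlat_flatOfFinset, image_id', attach_image_val]

theorem sum_faces_eq_sum_flagFaces (hd : d ≤ n) {M : Type*} [AddCommMonoid M] (f : ℕ → M) :
    ∑ σ ∈ (uniformMatroid d n).augmentedBergmanComplex.faces, f σ.card =
      ∑ p ∈ flagFaces (univ : Finset (Fin n)) d, f (p.1.card + p.2.card) := by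
  refine sum_bij (fun σ _ => flagOfFace σ) (fun σ hσ => (mem_faces_iff_flagOfFace_mem hd).1 hσ)
    (fun σ _ τ _ h => flagOfFace_injective h) (fun ⟨S, c⟩ hp => ?_)
    fun σ _ => by rw [card_flagOfFace]
  obtain ⟨σ, hσ⟩ := exists_flagOfFace_eq hd (S := S)
    fun F hF => ((mem_flagFaces.1 hp).2.2.1 F hF).2.1
  exact ⟨σ, (mem_faces_iff_flagOfFace_mem hd).2 (hσ ▸ hp), hσ⟩

theorem card_le_of_mem_faces (hd : d ≤ n) {σ : Finset (uniformMatroid d n).AugVertex}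
    (hσ : σ ∈ (uniformMatroid d n).augmentedBergmanComplex.faces) : σ.card ≤ d := by
  rw [← card_flagOfFace]
  exact card_add_card_le_of_mem_flagFaces ((mem_faces_iff_flagOfFace_mem hd).1 hσ)

theorem maxCard_augmentedBergmanComplex (hd : d ≤ n) :
    (uniformMatroid d n).augmentedBergmanComplex.maxCard = d := by
  refine le_antisymm (Finset.sup_le fun σ hσ => card_le_of_mem_faces hd hσ) ?_
  obtain ⟨S, -, hS⟩ := exists_subset_card_eq (s := (univ : Finset (Fin n))) (n := d)
    (by rwa [card_univ, Fintype.card_fin])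
  obtain ⟨σ, hσ⟩ := exists_flagOfFace_eq hd (S := S) (c := ∅) (by simp)
  have hface : σ ∈ (uniformMatroid d n).augmentedBergmanComplex.faces := by
    rw [mem_faces_iff_flagOfFace_mem hd, hσ, mem_flagFaces]
    exact ⟨subset_univ _, hS.le, by simp, by simp⟩
  calc d = σ.card := by rw [← card_flagOfFace, hσ, hS, card_empty, add_zero]
    _ ≤ _ := le_sup (f := card) hface

theorem pow_mul_pow_mul_one_sub_pow {R : Type*} [CommRing R] {x z : R} (h : x * z = 1) {s d : ℕ}
    (hs : s ≤ d) : x ^ d * (z ^ s * (1 - z) ^ (d - s)) = (x - 1) ^ (d - s) := by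
  obtain ⟨e, rfl⟩ := Nat.exists_eq_add_of_le hs
  rw [Nat.add_sub_cancel_left]
  calc x ^ (s + e) * (z ^ s * (1 - z) ^ e)
      = (x * z) ^ s * (x - x * z) ^ e := by rw [← mul_one_sub, mul_pow, mul_pow, pow_add]; ring
    _ = (x - 1) ^ e := by rw [h, one_pow, one_mul]

theorem single_mul_aeval_hPolynomial (hd : d ≤ n) :
    (HahnSeries.single (d : ℤ) (1 : ℤ) : LaurentSeries ℤ) *
        Polynomial.aeval (HahnSeries.single (-1 : ℤ) (1 : ℤ) : LaurentSeries ℤ)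
          (uniformMatroid d n).augmentedBergmanComplex.hPolynomial =
      HahnSeries.ofPowerSeries ℤ ℤ (chowTransform n d : PowerSeries ℤ) := by
  have hinv : (HahnSeries.single (1 : ℤ) (1 : ℤ) : LaurentSeries ℤ) *
      HahnSeries.single (-1 : ℤ) (1 : ℤ) = 1 := by
    rw [HahnSeries.single_mul_single, add_neg_cancel, mul_one, HahnSeries.single_zero_one]
  have hpow : (HahnSeries.single (d : ℤ) (1 : ℤ) : LaurentSeries ℤ) =
      HahnSeries.single (1 : ℤ) (1 : ℤ) ^ d := by
    rw [HahnSeries.single_pow, nsmul_one, one_pow]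
  have hflag : chowTransform n d = ∑ σ ∈ (uniformMatroid d n).augmentedBergmanComplex.faces,
      (Polynomial.X - 1 : Polynomial ℤ) ^ (d - σ.card) := by
    rw [sum_faces_eq_sum_flagFaces hd fun m => (Polynomial.X - 1 : Polynomial ℤ) ^ (d - m),
      ← flagPoly, flagPoly_eq_chowTransform (by rwa [card_univ, Fintype.card_fin]), card_univ,
      Fintype.card_fin]
  rw [hflag, FinSimplicialComplex.hPolynomial, maxCard_augmentedBergmanComplex hd, map_sum,
    mul_sum, ← Polynomial.coeToPowerSeries.ringHom_apply, map_sum, map_sum]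
  refine sum_congr rfl fun σ hσ => ?_
  rw [hpow, map_mul, map_pow, map_pow, map_sub, map_one (Polynomial.aeval _), Polynomial.aeval_X,
    pow_mul_pow_mul_one_sub_pow hinv (card_le_of_mem_faces hd hσ), map_pow, map_pow, map_sub,
    map_sub, RingHom.map_one, RingHom.map_one, Polynomial.coeToPowerSeries.ringHom_apply,
    Polynomial.coe_X, HahnSeries.ofPowerSeries_X]

end Bergman


/-- The identity `x^d h(Δ_{U_{d,n}}, 1/x) = ∑_{i=0}^d C(n-i-1, d-i) H_{U_{i,n}}(x)` of formal Laurent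
series in `x`, where `HahnSeries.single m 1` is `x^m`. The truncated subtraction `n - i - 1` differs
from the integer one only for `i = d = n`, where `C(-1, 0) = 1 = C(0, 0)`. -/
theorem mainTheorem4 (d n : ℕ) (hdn : d ≤ n) :
    (HahnSeries.single (d : ℤ) (1 : ℤ) : LaurentSeries ℤ) *
        Polynomial.aeval (HahnSeries.single (-1 : ℤ) (1 : ℤ) : LaurentSeries ℤ)
          (Matroid.uniformMatroid d n).augmentedBergmanComplex.hPolynomial =
      ∑ i ∈ Finset.range (d + 1), ((n - i - 1).choose (d - i) : LaurentSeries ℤ) *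
        HahnSeries.ofPowerSeries ℤ ℤ (Matroid.uniformMatroid i n).augmentedChowSeries := by
  rw [single_mul_aeval_hPolynomial hdn, chowTransform,
    ← Polynomial.coeToPowerSeries.ringHom_apply, map_sum, map_sum]
  refine Finset.sum_congr rfl fun i hi => ?_
  have := Finset.mem_range.1 hi
  rw [augmentedChowSeries_uniformMatroid (by omega : i ≤ n), map_mul, map_mul, map_natCast,
    map_natCast, Polynomial.coeToPowerSeries.ringHom_apply]
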